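/- Let $N\in\mathbb N$, $q>1$, and let $h_0:\mathbb R^N\to[0,\infty)$ be continuous with $h_0(y)\to 0$ as $|y|\to\infty$. Then the Cauchy problem $$\partial_\tau h - y\cdot\nabla h - q\,|\nabla h|^q = 0 \ \text{ in } (0,\infty)\times\mathbb R^N,\qquad h(0,\cdot)=h_0 ,$$ has a unique viscosity solution $h$ in the class of bounded continuous functions on $[0,\infty)\times\mathbb R^N$, and $$\lim_{\tau\to\infty}\|h(\tau)-h_s\|_\infty=\lim_{\tau\to\infty}\ \sup_{y\in\mathbb R^N}|h(\tau,y)-h_s(y)|=0,\qquad h_s(y):=\left(\|h_0\|_\infty-\gamma_q\,|y|^{q/(q-1)}\right)_+,$$ where $\gamma_q:=(q-1)\,q^{-q/(q-1)}$, $r_+:=\max\{r,0\}$, $|\cdot|$ is the Euclidean norm and $\|\cdot\|_\infty$ the supremum norm on $\mathbb R^N$. -/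

import Mathlib

open Set Filter Topology
open scoped ZeroAtInfty Gradient

noncomputable section

/-- The space `ℝ^N` with its Euclidean norm. -/
abbrev RN (N : ℕ) : Type := EuclideanSpace ℝ (Fin N)

/-- Viscosity subsolution inequality for `∂_τ u + H(y, ∇u) = 0` in `(0,∞) × ℝ^N`, tested with
`C¹` functions touching `u` from above. The function `u` is meant to be continuous; continuity is
required in `IsBCViscositySolution`. Values of `u` at times `τ ≤ 0` play no role. -/
def IsViscositySubsolution {N : ℕ} (H : RN N → RN N → ℝ) (u : ℝ → RN N → ℝ) : Prop :=
  ∀ φ : ℝ → RN N → ℝ, ContDiffOn ℝ 1 (fun p : ℝ × RN N => φ p.1 p.2) (Ioi 0 ×ˢ univ) →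
    ∀ τ : ℝ, 0 < τ → ∀ y : RN N,
      IsLocalMax (fun p : ℝ × RN N => u p.1 p.2 - φ p.1 p.2) (τ, y) →
        deriv (fun s => φ s y) τ + H y (∇ (φ τ) y) ≤ 0

/-- Viscosity supersolution inequality for `∂_τ u + H(y, ∇u) = 0` in `(0,∞) × ℝ^N`, tested with
`C¹` functions touching `u` from below. -/
def IsViscositySupersolution {N : ℕ} (H : RN N → RN N → ℝ) (u : ℝ → RN N → ℝ) : Prop :=
  ∀ φ : ℝ → RN N → ℝ, ContDiffOn ℝ 1 (fun p : ℝ × RN N => φ p.1 p.2) (Ioi 0 ×ˢ univ) →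
    ∀ τ : ℝ, 0 < τ → ∀ y : RN N,
      IsLocalMin (fun p : ℝ × RN N => u p.1 p.2 - φ p.1 p.2) (τ, y) →
        0 ≤ deriv (fun s => φ s y) τ + H y (∇ (φ τ) y)

/-- `u ∈ BC([0,∞) × ℝ^N)` is a viscosity solution of the Cauchy problem
`∂_τ u + H(y, ∇u) = 0` in `(0,∞) × ℝ^N`, `u(0) = u₀`. -/
structure IsBCViscositySolution {N : ℕ} (H : RN N → RN N → ℝ) (u₀ : RN N → ℝ)
    (u : ℝ → RN N → ℝ) : Prop where
  continuousOn : ContinuousOn (fun p : ℝ × RN N => u p.1 p.2) (Ici 0 ×ˢ univ)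
  bounded : ∃ C : ℝ, ∀ τ : ℝ, 0 ≤ τ → ∀ y : RN N, |u τ y| ≤ C
  initial : ∀ y : RN N, u 0 y = u₀ y
  subsolution : IsViscositySubsolution H u
  supersolution : IsViscositySupersolution H u

/-- The Hamiltonian `H(y, ξ) = - y · ξ - q |ξ|^q`. -/
def hamiltonian {N : ℕ} (q : ℝ) (y ξ : RN N) : ℝ :=
  -(inner ℝ y ξ) - q * ‖ξ‖ ^ q

/-- The constant `γ_q = (q - 1) q^{-q/(q-1)}`. -/
def gammaConst (q : ℝ) : ℝ := (q - 1) * q ^ (-(q / (q - 1)))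

/-- The profile `y ↦ (M - γ_q |y|^{q/(q-1)})_+`. -/
def profile {N : ℕ} (q M : ℝ) (y : RN N) : ℝ :=
  max (M - gammaConst q * ‖y‖ ^ (q / (q - 1))) 0

end

/-! Put `p = q/(q-1)`. In the variables `t = e^{qτ} - 1`, `x = e^τ y` the equation becomes `∂_t w =
|∇w|^q`, whose solution is the Hopf–Lax supremum of `h₀(z) - K_t(x - z)` over `z`, with `K_t(x) =
γ_q |x|^p t^{-1/(q-1)}`. Each function `c - K_{t+δ}(x - z)` is a classical solution where `t + δ >
0`, and the whole proof rests on these.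

Existence. The supremum is attained, so an exact solution touches `w` from below at any given point;
a test function touching from above has the same derivative there, which gives the subsolution
inequality. The supersolution inequality follows from the dynamic programming inequality
`hopfLax_sub_le_hopfLax` and the equality case of Young's inequality.

Uniqueness needs no doubling of variables: an arbitrary solution `g` is compared with smooth
functions only, and these serve directly as test functions. From below, `h₀(z) - η - K_{t+δ}(x - z)`
lies under `h₀` at time `0` for small `δ`. From above, finitely many functions `h₀(z) + η -
K_{t+η}(x - z)`, together with a slowly growing coercive supersolution, dominate `h₀` at time `0`;
their log-sum-exp is smooth and still a supersolution, since `r ↦ r^q` is convex. Both bounds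
converge to the Hopf–Lax function (`IsBCViscositySolution.eq_hopfLax`).

Large times. In the original variables the competitor `z` contributes `h₀(z) - γ_q |y - e^{-τ}z|^p
(1 - e^{-qτ})^{-1/(q-1)}`. For `z` in a compact set the shift `e^{-τ}z` vanishes and the last factor
tends to `1`; outside it `h₀` is small. Only `‖h₀‖` survives, which gives the profile. -/

noncomputable section

variable {N : ℕ}

/-! ### Derivatives of test functions -/

/-- The spatial part of a linear form on `ℝ × ℝ^N`. -/
def spatialPart (D : ℝ × RN N →L[ℝ] ℝ) : RN N →L[ℝ] ℝ := D.comp (ContinuousLinearMap.inr ℝ ℝ (RN N))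

lemma spatialPart_apply (D : ℝ × RN N →L[ℝ] ℝ) (v : RN N) : spatialPart D v = D (0, v) := rfl

lemma deriv_add_hamiltonian_eq {q : ℝ} {φ : ℝ → RN N → ℝ} {D : ℝ × RN N →L[ℝ] ℝ} {τ : ℝ} {y : RN N}
    (h : HasFDerivAt (fun p : ℝ × RN N => φ p.1 p.2) D (τ, y)) :
    deriv (fun s => φ s y) τ + hamiltonian q y (∇ (φ τ) y) =
      D (1, 0) - D (0, y) - q * ‖spatialPart D‖ ^ q := by
  have h1 : HasDerivAt (fun s => φ s y) (D (1, 0)) τ :=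
    HasFDerivAt.comp_hasDerivAt (l := fun p : ℝ × RN N => φ p.1 p.2) (f := fun s : ℝ => (s, y)) τ h
      ((hasDerivAt_id τ).prodMk (hasDerivAt_const τ y))
  have h2 : HasFDerivAt (φ τ) (spatialPart D) y :=
    HasFDerivAt.comp (g := fun p : ℝ × RN N => φ p.1 p.2) (f := fun z : RN N => (τ, z)) y h
      (hasFDerivAt_prodMk_right τ y)
  have h3 : ∇ (φ τ) y = (InnerProductSpace.toDual ℝ (RN N)).symm (spatialPart D) := by
    rw [gradient, h2.fderiv]
  rw [h1.deriv, hamiltonian, h3, LinearIsometryEquiv.norm_map, real_inner_comm,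
    InnerProductSpace.toDual_symm_apply, spatialPart_apply]
  ring

/-- The change of variables `(τ, y) ↦ (e^{qτ} - 1, e^τ y)`, which turns the equation
`∂_τ h - y · ∇h - q |∇h|^q = 0` into `∂_t w - |∇w|^q = 0`. -/
def rescale (q : ℝ) (p : ℝ × RN N) : ℝ × RN N :=
  (Real.exp (q * p.1) - 1, Real.exp p.1 • p.2)

lemma contDiff_rescale (q : ℝ) : ContDiff ℝ 1 (rescale q : ℝ × RN N → ℝ × RN N) := by
  unfold rescale; fun_prop

lemma exists_hasFDerivAt_rescale (q : ℝ) (τ : ℝ) (y : RN N) :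
    ∃ R : ℝ × RN N →L[ℝ] ℝ × RN N, HasFDerivAt (rescale q) R (τ, y) ∧
      R (1, 0) = (q * Real.exp (q * τ), Real.exp τ • y) ∧ ∀ v, R (0, v) = (0, Real.exp τ • v) := by
  have hd := ((contDiff_rescale q).differentiable one_ne_zero (τ, y)).hasFDerivAt (𝕜 := ℝ)
  refine ⟨_, hd, ?_, fun v => ?_⟩
  · have h1 : HasDerivAt (fun s : ℝ => rescale q (s, y)) (fderiv ℝ (rescale q) (τ, y) (1, 0)) τ :=
      HasFDerivAt.comp_hasDerivAt (l := rescale q) (f := fun s : ℝ => (s, y)) τ hd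
        ((hasDerivAt_id τ).prodMk (hasDerivAt_const τ y))
    have h2 : HasDerivAt (fun s : ℝ => rescale q (s, y))
        (q * Real.exp (q * τ), Real.exp τ • y) τ := by
      refine HasDerivAt.prodMk ?_ ((Real.hasDerivAt_exp τ).smul_const y)
      have := ((hasDerivAt_id τ).const_mul q).exp.sub_const 1
      simpa [mul_comm] using this
    exact h1.unique h2
  · have h1 : HasFDerivAt (fun z : RN N => rescale q (τ, z))
        ((fderiv ℝ (rescale q) (τ, y)).comp (ContinuousLinearMap.inr ℝ ℝ (RN N))) y :=
      HasFDerivAt.comp (g := rescale q) (f := fun z : RN N => (τ, z)) y hd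
        (hasFDerivAt_prodMk_right τ y)
    have h2 : HasFDerivAt (fun z : RN N => rescale q (τ, z))
        ((0 : RN N →L[ℝ] ℝ).prod (Real.exp τ • ContinuousLinearMap.id ℝ (RN N))) y :=
      (hasFDerivAt_const (Real.exp (q * τ) - 1) y).prodMk
        ((hasFDerivAt_id y).const_smul (Real.exp τ))
    have := congrArg (fun A : RN N →L[ℝ] ℝ × RN N => A v) (h1.unique h2)
    simpa using this

/-- The `τ`-derivative of `e^τ y` cancels the drift, and the time scale `e^{qτ}` matches `|e^τ ξ|^q
= e^{qτ}|ξ|^q`. The remaining factor is positive when `q > 0`, so sub- and supersolution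
inequalities carry over. -/
lemma exists_hasFDerivAt_comp_rescale {q : ℝ} {Φ : ℝ × RN N → ℝ} {D : ℝ × RN N →L[ℝ] ℝ}
    {τ : ℝ} {y : RN N} (h : HasFDerivAt Φ D (rescale q (τ, y))) :
    ∃ D' : ℝ × RN N →L[ℝ] ℝ, HasFDerivAt (fun p => Φ (rescale q p)) D' (τ, y) ∧
      D' (1, 0) - D' (0, y) - q * ‖spatialPart D'‖ ^ q =
        q * Real.exp (q * τ) * (D (1, 0) - ‖spatialPart D‖ ^ q) := by
  obtain ⟨R, hR, hR1, hR2⟩ := exists_hasFDerivAt_rescale q τ y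
  refine ⟨D.comp R, h.comp (τ, y) hR, ?_⟩
  have h0 : spatialPart (D.comp R) = Real.exp τ • spatialPart D := by
    ext v
    have : ((0 : ℝ), Real.exp τ • v) = Real.exp τ • ((0 : ℝ), v) := by simp
    rw [spatialPart_apply, ContinuousLinearMap.comp_apply, hR2, this, map_smul]
    rfl
  have h1 : (q * Real.exp (q * τ), Real.exp τ • y) =
      (q * Real.exp (q * τ)) • ((1 : ℝ), (0 : RN N)) + ((0 : ℝ), Real.exp τ • y) := by simp
  rw [h0, ContinuousLinearMap.comp_apply, ContinuousLinearMap.comp_apply, hR1, hR2, h1, map_add,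
    map_smul, norm_smul, Real.norm_of_nonneg (Real.exp_pos τ).le,
    Real.mul_rpow (Real.exp_pos τ).le (norm_nonneg _), ← Real.exp_mul, mul_comm τ q, smul_eq_mul]
  ring

/-! ### Comparison with smooth functions -/

/-- The penalty `θτ` makes `f - θτ` nonpositive after time `|K|/θ`, while the hypotheses do so at
time `0` and for `‖y‖ > R`. A positive value must therefore be maximised on a compact cylinder, at a
positive time. In the comparison theorems `θ` provides the strict inequality. -/
lemma exists_isLocalMax_sub_linear {f : ℝ → RN N → ℝ}
    (hf : ContinuousOn (fun p : ℝ × RN N => f p.1 p.2) (Ici 0 ×ˢ univ))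
    {K : ℝ} (hK : ∀ τ, 0 ≤ τ → ∀ y, f τ y ≤ K) {R : ℝ} (hR : ∀ τ, 0 ≤ τ → ∀ y, R < ‖y‖ → f τ y ≤ 0)
    (h0 : ∀ y, f 0 y ≤ 0) {σ : ℝ} (hσ : 0 ≤ σ) {z : RN N} (hpos : 0 < f σ z) :
    ∃ θ > 0, ∃ τ > 0, ∃ y, IsLocalMax (fun p : ℝ × RN N => f p.1 p.2 - θ * p.1) (τ, y) := by
  obtain ⟨θ, hθ, hθσ⟩ : ∃ θ > 0, θ * σ < f σ z := by
    -- The denominator `σ + 1` keeps `θσ` strictly below `f σ z` and also covers `σ = 0`.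
    refine ⟨f σ z / (σ + 1), by positivity, ?_⟩
    rw [div_mul_eq_mul_div, div_lt_iff₀ (by positivity)]
    nlinarith
  refine ⟨θ, hθ, ?_⟩
  set F : ℝ × RN N → ℝ := fun p => f p.1 p.2 - θ * p.1 with hF
  have hFc : ContinuousOn F (Ici 0 ×ˢ univ) := hf.sub (by fun_prop)
  have hσT : σ ≤ |K| / θ := by
    rw [le_div_iff₀ hθ]
    have := hK σ hσ z
    have := le_abs_self K
    linarith
  have hzR : ‖z‖ ≤ R := by
    by_contra! h
    exact absurd (hR σ hσ z h) (not_le.2 hpos)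
  obtain ⟨⟨τ, y⟩, ⟨hτ, -⟩, hmax⟩ := (isCompact_Icc.prod (isCompact_closedBall (0 : RN N) R)).exists_isMaxOn
    (s := Icc 0 (|K| / θ) ×ˢ Metric.closedBall (0 : RN N) R)
    ⟨(σ, z), ⟨hσ, hσT⟩, by simpa using hzR⟩
    (hFc.mono (prod_mono (fun t ht => ht.1) (subset_univ _)))
  have hge : F (σ, z) ≤ F (τ, y) := hmax ⟨⟨hσ, hσT⟩, by simpa using hzR⟩
  have hFpos : 0 < F (τ, y) := lt_of_lt_of_le (by simp only [hF]; linarith) hge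
  have hτ0 : 0 < τ := by
    refine lt_of_le_of_ne hτ.1 fun h => ?_
    simp only [hF, ← h] at hFpos
    linarith [h0 y]
  refine ⟨τ, hτ0, y, ?_⟩
  have hnhds : Ioi (0 : ℝ) ×ˢ (univ : Set (RN N)) ∈ 𝓝 (τ, y) :=
    prod_mem_nhds (Ioi_mem_nhds hτ0) univ_mem
  filter_upwards [hnhds]
  rintro ⟨s, x⟩ ⟨hs : 0 < s, -⟩
  change F (s, x) ≤ F (τ, y)
  by_cases hx : ‖x‖ ≤ R
  · by_cases hsT : s ≤ |K| / θ
    · exact hmax ⟨⟨hs.le, hsT⟩, by simpa using hx⟩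
    · rw [not_le, div_lt_iff₀ hθ] at hsT
      have := hK s hs.le x
      have := le_abs_self K
      have : F (s, x) = f s x - θ * s := rfl
      linarith
  · have := hR s hs.le x (not_le.1 hx)
    have : F (s, x) = f s x - θ * s := rfl
    nlinarith

lemma contDiffOn_comp_rescale {q : ℝ} (hq : 0 < q) {Φ : ℝ × RN N → ℝ}
    (hΦ : ContDiffOn ℝ 1 Φ (Ioi 0 ×ˢ univ)) :
    ContDiffOn ℝ 1 (fun p => Φ (rescale q p)) (Ioi 0 ×ˢ univ) := by
  refine hΦ.comp (contDiff_rescale q).contDiffOn fun p hp => ⟨?_, mem_univ _⟩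
  have : 0 < q * p.1 := mul_pos hq hp.1
  simpa [rescale] using this

lemma hasFDerivAt_of_contDiffOn {Φ : ℝ × RN N → ℝ} (hΦ : ContDiffOn ℝ 1 Φ (Ioi 0 ×ˢ univ)) {t : ℝ}
    (ht : 0 < t) (x : RN N) : HasFDerivAt Φ (fderiv ℝ Φ (t, x)) (t, x) :=
  ((hΦ.contDiffAt (prod_mem_nhds (Ioi_mem_nhds ht) univ_mem)).differentiableAt
    one_ne_zero).hasFDerivAt

lemma rescale_fst_pos {q : ℝ} (hq : 0 < q) {τ : ℝ} (hτ : 0 < τ) : 0 < Real.exp (q * τ) - 1 := by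
  have : 0 < q * τ := mul_pos hq hτ
  simpa using this

lemma continuousOn_comp_rescale {q : ℝ} (hq : 0 < q) {Φ : ℝ × RN N → ℝ}
    (hΦ : ContinuousOn Φ (Ici 0 ×ˢ univ)) :
    ContinuousOn (fun p => Φ (rescale q p)) (Ici 0 ×ˢ univ) := by
  refine hΦ.comp (contDiff_rescale q).continuous.continuousOn fun p hp => ⟨?_, mem_univ _⟩
  have : 0 ≤ q * p.1 := mul_nonneg hq.le hp.1
  simpa [rescale] using this

/-- If `g` exceeded `Φ` somewhere, `Φ + θτ` would touch `g` from above up to a constant, and the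
subsolution inequality would force `θ ≤ 0`. Coercivity of `Φ` replaces any assumption on `g` at
infinity beyond boundedness. -/
theorem IsBCViscositySolution.le_of_smooth_supersolution {q : ℝ} (hq : 0 < q) {u₀ : RN N → ℝ}
    {g : ℝ → RN N → ℝ} (hg : IsBCViscositySolution (hamiltonian q) u₀ g) {Φ : ℝ × RN N → ℝ}
    (hΦ : ContDiffOn ℝ 1 Φ (Ioi 0 ×ˢ univ)) (hΦc : ContinuousOn Φ (Ici 0 ×ˢ univ))
    (hΦs : ∀ t > 0, ∀ x,
      ‖spatialPart (fderiv ℝ Φ (t, x))‖ ^ q ≤ fderiv ℝ Φ (t, x) (1, 0))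
    (h0 : ∀ x, u₀ x ≤ Φ (0, x)) {K : ℝ} (hK : ∀ t ≥ 0, ∀ x, K ≤ Φ (t, x))
    (hcoer : ∀ C, ∃ R, ∀ τ ≥ 0, ∀ y, R < ‖y‖ → C ≤ Φ (rescale q (τ, y)))
    {τ : ℝ} (hτ : 0 ≤ τ) (y : RN N) : g τ y ≤ Φ (rescale q (τ, y)) := by
  by_contra! hlt
  obtain ⟨C, hC⟩ := hg.bounded
  obtain ⟨R, hR⟩ := hcoer C
  have hnn : ∀ s : ℝ, 0 ≤ s → 0 ≤ Real.exp (q * s) - 1 := fun s hs => by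
    simpa using mul_nonneg hq.le hs
  obtain ⟨θ, hθ, σ, hσ, z, hmax⟩ := exists_isLocalMax_sub_linear
    (f := fun s x => g s x - Φ (rescale q (s, x))) (K := C - K) (R := R)
    (hg.continuousOn.sub (continuousOn_comp_rescale hq hΦc))
    (fun s hs x => sub_le_sub (le_of_abs_le (hC s hs x)) (hK _ (hnn s hs) _))
    (fun s hs x hx => by linarith [le_of_abs_le (hC s hs x), hR s hs x hx])
    (fun x => by simpa [hg.initial x, rescale] using h0 x) hτ (sub_pos.2 hlt)
  obtain ⟨D, hD, hDeq⟩ := exists_hasFDerivAt_comp_rescale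
    (hasFDerivAt_of_contDiffOn hΦ (rescale_fst_pos hq hσ) (Real.exp σ • z))
  have hD' : HasFDerivAt (fun p : ℝ × RN N => Φ (rescale q p) + θ * p.1)
      (D + θ • ContinuousLinearMap.fst ℝ ℝ (RN N)) (σ, z) :=
    hD.add (hasFDerivAt_fst.const_mul θ)
  have key := hg.subsolution (fun s x => Φ (rescale q (s, x)) + θ * s)
    ((contDiffOn_comp_rescale hq hΦ).add (by fun_prop)) σ hσ z
    (by simpa only [sub_sub] using hmax)
  rw [deriv_add_hamiltonian_eq (φ := fun s x => Φ (rescale q (s, x)) + θ * s) hD'] at key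
  have hsp : spatialPart (D + θ • ContinuousLinearMap.fst ℝ ℝ (RN N)) = spatialPart D := by
    ext v; simp [spatialPart_apply]
  have hs := hΦs _ (rescale_fst_pos hq hσ) (Real.exp σ • z)
  have hnonneg : 0 ≤ q * Real.exp (q * σ) *
      (fderiv ℝ Φ (rescale q (σ, z)) (1, 0) -
        ‖spatialPart (fderiv ℝ Φ (rescale q (σ, z)))‖ ^ q) :=
    mul_nonneg (by positivity) (sub_nonneg.2 hs)
  rw [hsp] at key
  simp at key
  change _ = q * Real.exp (q * σ) * (fderiv ℝ Φ (rescale q (σ, z)) (1, 0) -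
        ‖spatialPart (fderiv ℝ Φ (rescale q (σ, z)))‖ ^ q) at hDeq
  linarith

theorem IsBCViscositySolution.ge_of_smooth_subsolution {q : ℝ} (hq : 0 < q) {u₀ : RN N → ℝ}
    {g : ℝ → RN N → ℝ} (hg : IsBCViscositySolution (hamiltonian q) u₀ g) {Φ : ℝ × RN N → ℝ}
    (hΦ : ContDiffOn ℝ 1 Φ (Ioi 0 ×ˢ univ)) (hΦc : ContinuousOn Φ (Ici 0 ×ˢ univ))
    (hΦs : ∀ t > 0, ∀ x,
      fderiv ℝ Φ (t, x) (1, 0) ≤ ‖spatialPart (fderiv ℝ Φ (t, x))‖ ^ q)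
    (h0 : ∀ x, Φ (0, x) ≤ u₀ x) {K : ℝ} (hK : ∀ t ≥ 0, ∀ x, Φ (t, x) ≤ K)
    (hcoer : ∀ C, ∃ R, ∀ τ ≥ 0, ∀ y, R < ‖y‖ → Φ (rescale q (τ, y)) ≤ C)
    {τ : ℝ} (hτ : 0 ≤ τ) (y : RN N) : Φ (rescale q (τ, y)) ≤ g τ y := by
  by_contra! hlt
  obtain ⟨C, hC⟩ := hg.bounded
  obtain ⟨R, hR⟩ := hcoer (-C)
  have hnn : ∀ s : ℝ, 0 ≤ s → 0 ≤ Real.exp (q * s) - 1 := fun s hs => by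
    simpa using mul_nonneg hq.le hs
  obtain ⟨θ, hθ, σ, hσ, z, hmax⟩ := exists_isLocalMax_sub_linear
    (f := fun s x => Φ (rescale q (s, x)) - g s x) (K := K + C) (R := R)
    ((continuousOn_comp_rescale hq hΦc).sub hg.continuousOn)
    (fun s hs x => by
      have : Φ (rescale q (s, x)) ≤ K := hK _ (hnn s hs) _
      linarith [neg_le_of_abs_le (hC s hs x)])
    (fun s hs x hx => by linarith [neg_le_of_abs_le (hC s hs x), hR s hs x hx])
    (fun x => by simpa [hg.initial x, rescale] using h0 x) hτ (sub_pos.2 hlt)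
  obtain ⟨D, hD, hDeq⟩ := exists_hasFDerivAt_comp_rescale
    (hasFDerivAt_of_contDiffOn hΦ (rescale_fst_pos hq hσ) (Real.exp σ • z))
  have hD' : HasFDerivAt (fun p : ℝ × RN N => Φ (rescale q p) - θ * p.1)
      (D - θ • ContinuousLinearMap.fst ℝ ℝ (RN N)) (σ, z) :=
    hD.sub (hasFDerivAt_fst.const_mul θ)
  have key := hg.supersolution (fun s x => Φ (rescale q (s, x)) - θ * s)
    ((contDiffOn_comp_rescale hq hΦ).sub (by fun_prop)) σ hσ z
    (by
      have heq : (fun p : ℝ × RN N => g p.1 p.2 - (Φ (rescale q (p.1, p.2)) - θ * p.1)) =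
          fun p => -(Φ (rescale q (p.1, p.2)) - g p.1 p.2 - θ * p.1) := by
        ext p
        ring
      exact heq ▸ hmax.neg)
  rw [deriv_add_hamiltonian_eq (φ := fun s x => Φ (rescale q (s, x)) - θ * s) hD'] at key
  have hsp : spatialPart (D - θ • ContinuousLinearMap.fst ℝ ℝ (RN N)) = spatialPart D := by
    ext v; simp [spatialPart_apply]
  have hs := hΦs _ (rescale_fst_pos hq hσ) (Real.exp σ • z)
  have hnonneg : q * Real.exp (q * σ) *
      (fderiv ℝ Φ (rescale q (σ, z)) (1, 0) -
        ‖spatialPart (fderiv ℝ Φ (rescale q (σ, z)))‖ ^ q) ≤ 0 :=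
    mul_nonpos_of_nonneg_of_nonpos (by positivity) (sub_nonpos.2 hs)
  rw [hsp] at key
  simp at key
  change _ = q * Real.exp (q * σ) * (fderiv ℝ Φ (rescale q (σ, z)) (1, 0) -
        ‖spatialPart (fderiv ℝ Φ (rescale q (σ, z)))‖ ^ q) at hDeq
  linarith

/-! ### The fundamental solution of `∂_t w = |∇w|^q` -/

/-- The kernel `γ_q |x|^{q/(q-1)} t^{-1/(q-1)}` of the Hopf–Lax formula for `∂_t w = |∇w|^q`. -/
def hopfLaxKernel (q t : ℝ) (x : RN N) : ℝ :=
  gammaConst q * (‖x‖ ^ (q / (q - 1)) * t ^ (-(1 / (q - 1))))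

lemma gammaConst_pos {q : ℝ} (hq : 1 < q) : 0 < gammaConst q :=
  mul_pos (sub_pos.2 hq) (Real.rpow_pos_of_pos (by linarith) _)

lemma one_lt_conj {q : ℝ} (hq : 1 < q) : 1 < q / (q - 1) := by
  rw [one_lt_div (by linarith)]; linarith

lemma conj_eq {q : ℝ} (hq : 1 < q) : q / (q - 1) = 1 / (q - 1) + 1 := by
  have : q - 1 ≠ 0 := by linarith
  field_simp
  ring

lemma gammaConst_mul_conj {q : ℝ} (hq : 1 < q) :
    gammaConst q * (q / (q - 1)) = q ^ (-(1 / (q - 1))) := by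
  have h1 : q - 1 ≠ 0 := by linarith
  have h2 : -(1 / (q - 1)) = -(q / (q - 1)) + 1 := by rw [conj_eq hq]; ring
  rw [gammaConst, h2, Real.rpow_add_one (by linarith)]
  field_simp

lemma hopfLaxKernel_nonneg {q : ℝ} (hq : 1 < q) {t : ℝ} (ht : 0 ≤ t) (x : RN N) :
    0 ≤ hopfLaxKernel q t x := by
  have := gammaConst_pos hq
  unfold hopfLaxKernel; positivity

lemma hopfLaxKernel_zero {q : ℝ} (hq : 1 < q) (t : ℝ) : hopfLaxKernel q t (0 : RN N) = 0 := by
  have := one_lt_conj hq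
  rw [hopfLaxKernel, norm_zero, Real.zero_rpow (by linarith)]; ring

/-- This perspective form `t L(x/t)` makes the convexity of `L` available. -/
lemma hopfLaxKernel_eq_mul {q : ℝ} (hq : 1 < q) {t : ℝ} (ht : 0 < t) (x : RN N) :
    hopfLaxKernel q t x = t * (gammaConst q * (‖x‖ / t) ^ (q / (q - 1))) := by
  have h2 : -(1 / (q - 1)) = -(q / (q - 1)) + 1 := by rw [conj_eq hq]; ring
  rw [hopfLaxKernel, h2, Real.rpow_add_one ht.ne', Real.div_rpow (norm_nonneg _) ht.le,
    Real.rpow_neg ht.le]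
  ring

lemma hopfLaxKernel_smul {q : ℝ} (hq : 1 < q) {t : ℝ} (ht : 0 < t) (a : RN N) :
    hopfLaxKernel q t (t ^ (1 / q) • a) = gammaConst q * ‖a‖ ^ (q / (q - 1)) := by
  have h1 : q - 1 ≠ 0 := by linarith
  have h0 : q ≠ 0 := by linarith
  have h2 : 1 / q * (q / (q - 1)) + -(1 / (q - 1)) = 0 := by field_simp; ring
  have hpos : 0 < t ^ (1 / q) := Real.rpow_pos_of_pos ht _
  rw [hopfLaxKernel, norm_smul, Real.norm_of_nonneg hpos.le, Real.mul_rpow hpos.le (norm_nonneg _),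
    ← Real.rpow_mul ht.le, mul_right_comm, ← Real.rpow_add ht, h2, Real.rpow_zero, one_mul]

/-- `x/t` is the convex combination of `(x - s a)/(t - s)` and `a` with weights `(t - s)/t` and
`s/t`; apply convexity of `r ↦ r^{q/(q-1)}`. -/
lemma hopfLaxKernel_le_add {q : ℝ} (hq : 1 < q) {s t : ℝ} (hs : 0 < s) (hst : s < t) (x a : RN N) :
    hopfLaxKernel q t x ≤
      hopfLaxKernel q (t - s) (x - s • a) + s * (gammaConst q * ‖a‖ ^ (q / (q - 1))) := by
  have ht : 0 < t := hs.trans hst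
  have hts : 0 < t - s := sub_pos.2 hst
  have hp := one_lt_conj hq
  rw [hopfLaxKernel_eq_mul hq ht, hopfLaxKernel_eq_mul hq hts]
  have hconv := (convexOn_rpow hp.le).2 (mem_Ici.2 (by positivity : 0 ≤ ‖x - s • a‖ / (t - s)))
    (mem_Ici.2 (norm_nonneg a)) (by positivity : 0 ≤ (t - s) / t) (by positivity : 0 ≤ s / t)
    (by field_simp; ring)
  simp only [smul_eq_mul] at hconv
  have hnorm : ‖x‖ / t ≤ (t - s) / t * (‖x - s • a‖ / (t - s)) + s / t * ‖a‖ := by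
    have h1 : ‖x‖ ≤ ‖x - s • a‖ + s * ‖a‖ := by
      calc ‖x‖ = ‖(x - s • a) + s • a‖ := by simp
        _ ≤ ‖x - s • a‖ + ‖s • a‖ := norm_add_le _ _
        _ = ‖x - s • a‖ + s * ‖a‖ := by rw [norm_smul, Real.norm_of_nonneg hs.le]
    have h2 : (t - s) / t * (‖x - s • a‖ / (t - s)) + s / t * ‖a‖ =
        (‖x - s • a‖ + s * ‖a‖) / t := by field_simp
    rw [h2]
    gcongr
  have hle := (Real.rpow_le_rpow (by positivity) hnorm (by linarith)).trans hconv
  have hγ := gammaConst_pos hq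
  calc t * (gammaConst q * (‖x‖ / t) ^ (q / (q - 1)))
      ≤ t * (gammaConst q * ((t - s) / t * (‖x - s • a‖ / (t - s)) ^ (q / (q - 1)) +
          s / t * ‖a‖ ^ (q / (q - 1)))) := by gcongr
    _ = _ := by field_simp

/-- Equality in Young's inequality `P a ≤ |P|^q + γ_q |a|^{q/(q-1)}`. -/
lemma exists_norm_rpow_eq {q : ℝ} (hq : 1 < q) (P : RN N →L[ℝ] ℝ) :
    ∃ a, P a - gammaConst q * ‖a‖ ^ (q / (q - 1)) = ‖P‖ ^ q := by
  set p := (InnerProductSpace.toDual ℝ (RN N)).symm P with hp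
  have hnorm : ‖P‖ = ‖p‖ := by rw [hp, LinearIsometryEquiv.norm_map]
  have hP : ∀ a, P a = inner ℝ p a := fun a => by
    rw [hp, InnerProductSpace.toDual_symm_apply]
  have hconj := one_lt_conj hq
  rcases eq_or_ne p 0 with h0 | h0
  · refine ⟨0, ?_⟩
    rw [hnorm, h0, map_zero, norm_zero, Real.zero_rpow (by linarith),
      Real.zero_rpow (by linarith)]
    ring
  · have hpos : 0 < ‖p‖ := norm_pos_iff.2 h0
    have h1 : q - 1 ≠ 0 := by linarith
    have hq0 : 0 < q := by linarith
    -- The extremal `a` is the gradient of `ξ ↦ |ξ|^q` at `p`.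
    refine ⟨(q * ‖p‖ ^ (q - 2)) • p, ?_⟩
    have e1 : ‖p‖ ^ (q - 2) * (‖p‖ * ‖p‖) = ‖p‖ ^ q := by
      rw [← sq, ← Real.rpow_natCast, ← Real.rpow_add hpos]; norm_num
    have e2 : ‖p‖ ^ (q - 2) * ‖p‖ = ‖p‖ ^ (q - 1) := by
      rw [← Real.rpow_add_one hpos.ne']; ring_nf
    have e3 : (‖p‖ ^ (q - 1)) ^ (q / (q - 1)) = ‖p‖ ^ q := by
      rw [← Real.rpow_mul hpos.le]; congr 1; field_simp
    have e4 : q ^ (-(q / (q - 1))) * q ^ (q / (q - 1)) = 1 := by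
      rw [← Real.rpow_add hq0, neg_add_cancel, Real.rpow_zero]
    rw [hP, hnorm, inner_smul_right, real_inner_self_eq_norm_mul_norm, mul_assoc, e1, norm_smul,
      Real.norm_of_nonneg (by positivity), mul_assoc, e2, Real.mul_rpow hq0.le (by positivity), e3,
      gammaConst]
    linear_combination (-(q - 1) * ‖p‖ ^ q) * e4

/-- With `r = |x - z|` and `T = t + δ`, the spatial gradient has norm `b = (r/(qT))^{1/(q-1)}`, and
the value of `γ_q` makes the time derivative equal to `b^q`. A shift `δ > 0` keeps the function
smooth up to `t = 0`. -/
lemma exists_hasFDerivAt_const_sub_hopfLaxKernel {q : ℝ} (hq : 1 < q) (c δ : ℝ) (z : RN N) {t : ℝ}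
    (ht : 0 < t + δ) (x : RN N) :
    ∃ D : ℝ × RN N →L[ℝ] ℝ,
      HasFDerivAt (fun p : ℝ × RN N => c - hopfLaxKernel q (p.1 + δ) (p.2 - z)) D (t, x) ∧
      D (1, 0) = ‖spatialPart D‖ ^ q := by
  have hp := one_lt_conj hq
  have hq0 : 0 < q := by linarith
  have h1 : q - 1 ≠ 0 := by linarith
  have hα : 0 < 1 / (q - 1) := one_div_pos.2 (by linarith)
  have d1 : HasFDerivAt (fun p : ℝ × RN N => ‖p.2 - z‖ ^ (q / (q - 1))) _ (t, x) :=
    HasFDerivAt.comp (g := fun v : RN N => ‖v‖ ^ (q / (q - 1)))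
      (f := fun p : ℝ × RN N => p.2 - z) (t, x) (hasFDerivAt_norm_rpow (x - z) hp)
      (hasFDerivAt_snd.sub_const z)
  have d2 : HasFDerivAt (fun p : ℝ × RN N => (p.1 + δ) ^ (-(1 / (q - 1)))) _ (t, x) :=
    (hasFDerivAt_fst.add_const δ).rpow_const (Or.inl ht.ne')
  refine ⟨_, ((d1.mul d2).const_mul (gammaConst q)).const_sub c, ?_⟩
  set r := ‖x - z‖ with hr
  have hr0 : 0 ≤ r := norm_nonneg _
  set T := t + δ with hT
  set b := (r / (q * T)) ^ (1 / (q - 1)) with hb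
  have hb0 : 0 ≤ b := by positivity
  have hbq : b ^ q = (r / (q * T)) ^ (q / (q - 1)) := by
    rw [hb, ← Real.rpow_mul (by positivity)]; congr 1; ring
  have hcoef : gammaConst q * (T ^ (-(1 / (q - 1))) * (q / (q - 1) * r ^ (q / (q - 1) - 2))) * r
      = b := by
    have e1 : r ^ (q / (q - 1) - 2) * r = r ^ (1 / (q - 1)) := by
      rcases hr0.eq_or_lt with h | h
      · rw [← h, Real.zero_rpow hα.ne', mul_zero]
      · rw [← Real.rpow_add_one h.ne', conj_eq hq]; ring_nf
    rw [hb, Real.div_rpow hr0 (by positivity), Real.mul_rpow hq0.le ht.le,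
      Real.rpow_neg ht.le]
    have e2 := gammaConst_mul_conj hq
    rw [Real.rpow_neg hq0.le] at e2
    calc _ = (gammaConst q * (q / (q - 1))) * (T ^ (1 / (q - 1)))⁻¹ *
          (r ^ (q / (q - 1) - 2) * r) := by ring
      _ = _ := by rw [e1, e2]; field_simp
  have hsp : ∀ D : ℝ × RN N →L[ℝ] ℝ, spatialPart D = -((gammaConst q * (T ^ (-(1 / (q - 1))) *
      (q / (q - 1) * r ^ (q / (q - 1) - 2)))) • innerSL ℝ (x - z)) → ‖spatialPart D‖ = b := by
    intro D hD
    rw [hD, norm_neg, norm_smul, innerSL_apply_norm, Real.norm_of_nonneg, hcoef]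
    have := gammaConst_pos hq
    positivity
  rw [hsp _ ?_, hbq]
  · have e1 : (-(1 / (q - 1)) - 1 : ℝ) = -(q / (q - 1)) := by rw [conj_eq hq]; ring
    simp
    rw [one_div] at e1
    rw [e1, Real.div_rpow hr0 (by positivity), Real.mul_rpow hq0.le ht.le, Real.rpow_neg ht.le,
      gammaConst, Real.rpow_neg hq0.le]
    field_simp
  · ext v
    simp [spatialPart_apply]
    ring

lemma contDiffOn_const_sub_hopfLaxKernel {q : ℝ} (hq : 1 < q) (c : ℝ) {δ : ℝ} (z : RN N) :
    ContDiffOn ℝ 1 (fun p : ℝ × RN N => c - hopfLaxKernel q (p.1 + δ) (p.2 - z))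
      (Ioi (-δ) ×ˢ univ) := by
  unfold hopfLaxKernel
  refine contDiffOn_const.sub (contDiffOn_const.mul (ContDiffOn.mul ?_ ?_))
  · exact ((contDiff_norm_rpow (one_lt_conj hq)).comp (contDiff_snd.sub contDiff_const)).contDiffOn
  · refine ContDiffOn.rpow_const_of_ne (by fun_prop) fun p hp => ?_
    have : -δ < p.1 := hp.1
    linarith

/-! ### Smooth maxima of supersolutions -/

/-- The smooth maximum `ε log ∑ exp (φ_i / ε)` of finitely many functions. -/
def softMax {ι X : Type*} (s : Finset ι) (ε : ℝ) (φ : ι → X → ℝ) (p : X) : ℝ :=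
  ε * Real.log (∑ i ∈ s, Real.exp (φ i p / ε))

section softMax

variable {ι X : Type*} {s : Finset ι} {ε : ℝ} {φ : ι → X → ℝ}

lemma sum_exp_pos (hs : s.Nonempty) (ε : ℝ) (φ : ι → X → ℝ) (p : X) :
    0 < ∑ i ∈ s, Real.exp (φ i p / ε) :=
  Finset.sum_pos (fun _ _ => Real.exp_pos _) hs

lemma le_softMax (hε : 0 < ε) {i : ι} (hi : i ∈ s) (p : X) : φ i p ≤ softMax s ε φ p := by
  have h1 : Real.exp (φ i p / ε) ≤ ∑ j ∈ s, Real.exp (φ j p / ε) :=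
    Finset.single_le_sum (f := fun j => Real.exp (φ j p / ε)) (fun _ _ => (Real.exp_pos _).le) hi
  have h2 := Real.log_le_log (Real.exp_pos _) h1
  rw [Real.log_exp, div_le_iff₀ hε] at h2
  rw [softMax]
  linarith

lemma softMax_le (hs : s.Nonempty) (hε : 0 < ε) {p : X} {M : ℝ} (hM : ∀ i ∈ s, φ i p ≤ M) :
    softMax s ε φ p ≤ M + ε * Real.log s.card := by
  have hcard : (0 : ℝ) < s.card := by exact_mod_cast hs.card_pos
  have h1 : ∑ i ∈ s, Real.exp (φ i p / ε) ≤ s.card * Real.exp (M / ε) := by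
    rw [← nsmul_eq_mul]
    exact Finset.sum_le_card_nsmul _ _ _ fun i hi => by
      have := hM i hi
      gcongr
  have h2 := Real.log_le_log (sum_exp_pos hs ε φ p) h1
  rw [Real.log_mul hcard.ne' (Real.exp_pos _).ne', Real.log_exp] at h2
  calc softMax s ε φ p ≤ ε * (Real.log s.card + M / ε) := by unfold softMax; gcongr
    _ = _ := by field_simp; ring

lemma continuousOn_softMax [TopologicalSpace X] {S : Set X} (hs : s.Nonempty)
    (hφ : ∀ i ∈ s, ContinuousOn (φ i) S) : ContinuousOn (softMax s ε φ) S :=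
  continuousOn_const.mul <| ContinuousOn.log
    (continuousOn_finsetSum _ fun i hi => ((hφ i hi).div_const ε).rexp)
    fun p _ => (sum_exp_pos hs ε φ p).ne'

lemma contDiffOn_softMax [NormedAddCommGroup X] [NormedSpace ℝ X] {S : Set X} (hs : s.Nonempty)
    (hφ : ∀ i ∈ s, ContDiffOn ℝ 1 (φ i) S) : ContDiffOn ℝ 1 (softMax s ε φ) S :=
  contDiffOn_const.mul <| ContDiffOn.log
    (ContDiffOn.sum fun i hi => ((hφ i hi).div_const ε).exp)
    fun p _ => (sum_exp_pos hs ε φ p).ne'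

lemma hasFDerivAt_softMax [NormedAddCommGroup X] [NormedSpace ℝ X] (hs : s.Nonempty) (hε : 0 < ε)
    {p : X} {D : ι → X →L[ℝ] ℝ} (hD : ∀ i ∈ s, HasFDerivAt (φ i) (D i) p) :
    HasFDerivAt (softMax s ε φ)
      (∑ i ∈ s, (Real.exp (φ i p / ε) / ∑ j ∈ s, Real.exp (φ j p / ε)) • D i) p := by
  have h1 : HasFDerivAt (fun x => ∑ i ∈ s, Real.exp (φ i x / ε))
      (∑ i ∈ s, Real.exp (φ i p / ε) • (ε⁻¹ • D i)) p :=
    HasFDerivAt.fun_sum fun i hi => by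
      simpa only [div_eq_mul_inv] using ((hD i hi).mul_const ε⁻¹).exp
  refine ((h1.log (sum_exp_pos hs ε φ p).ne').const_mul ε).congr_fderiv ?_
  rw [Finset.smul_sum, Finset.smul_sum]
  refine Finset.sum_congr rfl fun i _ => ?_
  simp only [smul_smul]
  congr 1
  field_simp

end softMax

/-- The derivative of the soft maximum is a convex combination of the derivatives `D i`, and `ξ ↦
‖ξ‖^q` is convex, so the supersolution inequality survives averaging. -/
lemma norm_spatialPart_fderiv_softMax_le {ι : Type*} {s : Finset ι} (hs : s.Nonempty) {ε : ℝ}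
    (hε : 0 < ε) {q : ℝ} (hq : 1 < q) {φ : ι → ℝ × RN N → ℝ} {p : ℝ × RN N}
    {D : ι → ℝ × RN N →L[ℝ] ℝ} (hD : ∀ i ∈ s, HasFDerivAt (φ i) (D i) p)
    (hle : ∀ i ∈ s, ‖spatialPart (D i)‖ ^ q ≤ D i (1, 0)) :
    ‖spatialPart (fderiv ℝ (softMax s ε φ) p)‖ ^ q ≤ fderiv ℝ (softMax s ε φ) p (1, 0) := by
  rw [(hasFDerivAt_softMax hs hε hD).fderiv]
  set w : ι → ℝ := fun i => Real.exp (φ i p / ε) / ∑ j ∈ s, Real.exp (φ j p / ε) with hw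
  have hpos := sum_exp_pos hs ε φ p
  have hw0 : ∀ i ∈ s, 0 ≤ w i := fun i _ => by positivity
  have hw1 : ∑ i ∈ s, w i = 1 := by
    rw [hw, ← Finset.sum_div, div_self hpos.ne']
  have hsp : spatialPart (∑ i ∈ s, w i • D i) = ∑ i ∈ s, w i • spatialPart (D i) := by
    ext v; simp [spatialPart_apply]
  have hnorm : ‖spatialPart (∑ i ∈ s, w i • D i)‖ ≤ ∑ i ∈ s, w i • ‖spatialPart (D i)‖ := by
    rw [hsp]
    refine (norm_sum_le _ _).trans (Finset.sum_le_sum fun i hi => ?_)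
    rw [norm_smul, Real.norm_of_nonneg (hw0 i hi), smul_eq_mul]
  calc ‖spatialPart (∑ i ∈ s, w i • D i)‖ ^ q
      ≤ (∑ i ∈ s, w i • ‖spatialPart (D i)‖) ^ q :=
        Real.rpow_le_rpow (norm_nonneg _) hnorm (by linarith)
    _ ≤ ∑ i ∈ s, w i • ‖spatialPart (D i)‖ ^ q :=
        (convexOn_rpow hq.le).map_sum_le hw0 hw1 fun i _ => norm_nonneg _
    _ ≤ ∑ i ∈ s, w i • D i (1, 0) := Finset.sum_le_sum fun i hi =>
        smul_le_smul_of_nonneg_left (hle i hi) (hw0 i hi)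
    _ = (∑ i ∈ s, w i • D i) (1, 0) := by simp

/-- A smooth supersolution of `∂_t w = |∇w|^q` which is coercive and grows slowly for small `β`. -/
def coerciveSupersolution (q β c : ℝ) (p : ℝ × RN N) : ℝ :=
  c + β * √(1 + ‖p.2‖ ^ 2) + β ^ q * p.1

lemma contDiff_coerciveSupersolution (q β c : ℝ) :
    ContDiff ℝ 1 (coerciveSupersolution q β c : ℝ × RN N → ℝ) := by
  unfold coerciveSupersolution
  refine ((contDiff_const.add (contDiff_const.mul (ContDiff.sqrt ?_ fun p => ?_))).add
    (contDiff_const.mul contDiff_fst))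
  · exact contDiff_const.add (contDiff_snd.norm_sq ℝ)
  · positivity

/-- `√(1 + |x|²)` is `1`-Lipschitz, so the spatial gradient has norm at most `β`, while the time
derivative is `β^q`. -/
lemma exists_hasFDerivAt_coerciveSupersolution {q β : ℝ} (hq : 1 < q) (hβ : 0 ≤ β) (c : ℝ)
    (p : ℝ × RN N) : ∃ D : ℝ × RN N →L[ℝ] ℝ, HasFDerivAt (coerciveSupersolution q β c) D p ∧
      ‖spatialPart D‖ ^ q ≤ D (1, 0) := by
  have hpos : 0 < 1 + ‖p.2‖ ^ 2 := by positivity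
  have h1 := ((((hasFDerivAt_snd (𝕜 := ℝ) (p := p)).norm_sq.const_add 1).sqrt hpos.ne').const_mul
    β).const_add c
  refine ⟨_, h1.add (hasFDerivAt_fst.const_mul (β ^ q)), ?_⟩
  have hle : ‖p.2‖ ≤ √(1 + ‖p.2‖ ^ 2) := Real.le_sqrt_of_sq_le (by linarith)
  have hs : 0 < √(1 + ‖p.2‖ ^ 2) := Real.sqrt_pos.2 hpos
  have h10 : ∀ D : ℝ × RN N →L[ℝ] ℝ, ‖spatialPart D‖ ≤ β → D (1, 0) = β ^ q →
      ‖spatialPart D‖ ^ q ≤ D (1, 0) := fun D h h' => by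
    rw [h']
    exact Real.rpow_le_rpow (norm_nonneg _) h (by linarith)
  refine h10 _ (ContinuousLinearMap.opNorm_le_bound _ hβ fun v => ?_) ?_
  · have hin := abs_real_inner_le_norm p.2 v
    simp [spatialPart_apply]
    rw [abs_of_nonneg hβ, abs_of_pos hs]
    refine mul_le_mul_of_nonneg_left ?_ hβ
    calc (√(1 + ‖p.2‖ ^ 2))⁻¹ * 2⁻¹ * (2 * |inner ℝ p.2 v|)
        = |inner ℝ p.2 v| / √(1 + ‖p.2‖ ^ 2) := by field_simp
      _ ≤ √(1 + ‖p.2‖ ^ 2) * ‖v‖ / √(1 + ‖p.2‖ ^ 2) := by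
        gcongr
        exact hin.trans (by gcongr)
      _ = ‖v‖ := by field_simp
  · simp

/-! ### The Hopf–Lax formula -/

/-- A radius such that `‖h₀‖ ≤ γ_q |a|^{q/(q-1)}` outside of the ball with that radius. -/
def hopfLaxRadius (q : ℝ) (h₀ : C₀(RN N, ℝ)) : ℝ := (‖h₀‖ / gammaConst q) ^ (q / (q - 1))⁻¹

/-- The Hopf–Lax solution `w(t, x) = sup_a (h₀(x - t^{1/q} a) - γ_q |a|^{q/(q-1)})` of
`∂_t w = |∇w|^q`, `w(0) = h₀`. -/
def hopfLax (q : ℝ) (h₀ : C₀(RN N, ℝ)) (p : ℝ × RN N) : ℝ :=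
  sSup ((fun a => h₀ (p.2 - p.1 ^ (1 / q) • a) - gammaConst q * ‖a‖ ^ (q / (q - 1))) ''
    Metric.closedBall 0 (hopfLaxRadius q h₀))

section hopfLax

variable {q : ℝ} {h₀ : C₀(RN N, ℝ)}

lemma apply_le_norm (h₀ : C₀(RN N, ℝ)) (x : RN N) : h₀ x ≤ ‖h₀‖ :=
  (le_abs_self _).trans (h₀.toBCF.norm_coe_le_norm x)

lemma hopfLaxRadius_nonneg (hq : 1 < q) : 0 ≤ hopfLaxRadius q h₀ := by
  have := gammaConst_pos hq
  unfold hopfLaxRadius; positivity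

lemma norm_le_of_hopfLaxRadius_le (hq : 1 < q) {r : ℝ} (hr : hopfLaxRadius q h₀ ≤ r) :
    ‖h₀‖ ≤ gammaConst q * r ^ (q / (q - 1)) := by
  have hγ := gammaConst_pos hq
  have hp := one_lt_conj hq
  have h1 := Real.rpow_le_rpow (hopfLaxRadius_nonneg hq) hr (by linarith : 0 ≤ q / (q - 1))
  rw [hopfLaxRadius, Real.rpow_inv_rpow (by positivity) (by linarith), div_le_iff₀ hγ] at h1
  linarith

lemma continuous_hopfLax_integrand (hq : 1 < q) (h₀ : C₀(RN N, ℝ)) :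
    Continuous fun r : (ℝ × RN N) × RN N =>
      h₀ (r.1.2 - r.1.1 ^ (1 / q) • r.2) - gammaConst q * ‖r.2‖ ^ (q / (q - 1)) := by
  have hp := one_lt_conj hq
  have h1 : Continuous fun r : (ℝ × RN N) × RN N => r.1.1 ^ (1 / q) :=
    (Real.continuous_rpow_const (one_div_nonneg.2 (by linarith))).comp (by fun_prop)
  have h2 : Continuous fun r : (ℝ × RN N) × RN N => ‖r.2‖ ^ (q / (q - 1)) :=
    (Real.continuous_rpow_const (by linarith)).comp (by fun_prop)
  have := map_continuous h₀
  fun_prop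

/-- Substituting `z = x - t^{1/q} a` removes the singularity of the kernel at `t = 0`, and the fixed
compact ball of competitors `a` then gives joint continuity down to the initial time. -/
lemma continuous_hopfLax (hq : 1 < q) (h₀ : C₀(RN N, ℝ)) : Continuous (hopfLax q h₀) :=
  (isCompact_closedBall (0 : RN N) (hopfLaxRadius q h₀)).continuous_sSup
    (f := fun (p : ℝ × RN N) a =>
      h₀ (p.2 - p.1 ^ (1 / q) • a) - gammaConst q * ‖a‖ ^ (q / (q - 1)))
    (continuous_hopfLax_integrand hq h₀)

lemma isCompact_hopfLax_image (hq : 1 < q) (h₀ : C₀(RN N, ℝ)) (p : ℝ × RN N) :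
    IsCompact ((fun a => h₀ (p.2 - p.1 ^ (1 / q) • a) - gammaConst q * ‖a‖ ^ (q / (q - 1))) ''
      Metric.closedBall 0 (hopfLaxRadius q h₀)) :=
  (isCompact_closedBall (0 : RN N) (hopfLaxRadius q h₀)).image
    ((continuous_hopfLax_integrand hq h₀).comp (by fun_prop : Continuous fun a => (p, a)))

lemma exists_hopfLax_eq (hq : 1 < q) (h₀ : C₀(RN N, ℝ)) (p : ℝ × RN N) :
    ∃ a, hopfLax q h₀ p =
      h₀ (p.2 - p.1 ^ (1 / q) • a) - gammaConst q * ‖a‖ ^ (q / (q - 1)) := by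
  obtain ⟨a, -, ha⟩ := (isCompact_hopfLax_image hq h₀ p).sSup_mem
    ((Metric.nonempty_closedBall.2 (hopfLaxRadius_nonneg hq)).image _)
  exact ⟨a, ha.symm⟩

/-- Restricting to the ball loses nothing: outside it the expression is at most `0`, hence at most
its value `h₀ p.2 ≥ 0` at `a = 0`. -/
lemma le_hopfLax (hq : 1 < q) (h0 : ∀ x, 0 ≤ h₀ x) (p : ℝ × RN N) (a : RN N) :
    h₀ (p.2 - p.1 ^ (1 / q) • a) - gammaConst q * ‖a‖ ^ (q / (q - 1)) ≤ hopfLax q h₀ p := by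
  have key : ∀ b ∈ Metric.closedBall (0 : RN N) (hopfLaxRadius q h₀),
      h₀ (p.2 - p.1 ^ (1 / q) • b) - gammaConst q * ‖b‖ ^ (q / (q - 1)) ≤ hopfLax q h₀ p :=
    fun b hb => le_csSup (isCompact_hopfLax_image hq h₀ p).bddAbove (mem_image_of_mem _ hb)
  by_cases ha : ‖a‖ ≤ hopfLaxRadius q h₀
  · exact key a (by simpa using ha)
  · have h1 := key 0 (by simpa using hopfLaxRadius_nonneg hq)
    have h2 := norm_le_of_hopfLaxRadius_le hq (not_le.1 ha).le
    have h3 := apply_le_norm h₀ (p.2 - p.1 ^ (1 / q) • a)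
    have hp := one_lt_conj hq
    rw [norm_zero, Real.zero_rpow (by linarith), smul_zero, sub_zero, mul_zero, sub_zero] at h1
    linarith [h0 p.2]

lemma apply_le_hopfLax (hq : 1 < q) (h0 : ∀ x, 0 ≤ h₀ x) (p : ℝ × RN N) :
    h₀ p.2 ≤ hopfLax q h₀ p := by
  have hp := (zero_lt_one.trans (one_lt_conj hq)).ne'
  have h1 := le_hopfLax hq h0 p 0
  rwa [norm_zero, Real.zero_rpow hp, smul_zero, sub_zero, mul_zero, sub_zero] at h1

lemma hopfLax_nonneg (hq : 1 < q) (h0 : ∀ x, 0 ≤ h₀ x) (p : ℝ × RN N) : 0 ≤ hopfLax q h₀ p :=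
  (h0 _).trans (apply_le_hopfLax hq h0 p)

lemma hopfLax_le_norm (hq : 1 < q) (p : ℝ × RN N) : hopfLax q h₀ p ≤ ‖h₀‖ := by
  obtain ⟨a, ha⟩ := exists_hopfLax_eq hq h₀ p
  have := gammaConst_pos hq
  have h1 : 0 ≤ gammaConst q * ‖a‖ ^ (q / (q - 1)) := by positivity
  linarith [apply_le_norm h₀ (p.2 - p.1 ^ (1 / q) • a)]

lemma hopfLax_zero (hq : 1 < q) (h0 : ∀ x, 0 ≤ h₀ x) (x : RN N) : hopfLax q h₀ (0, x) = h₀ x := by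
  have hz : (0 : ℝ) ^ (1 / q) = 0 := Real.zero_rpow (one_div_pos.2 (by linarith)).ne'
  refine le_antisymm ?_ (apply_le_hopfLax hq h0 (0, x))
  obtain ⟨a, ha⟩ := exists_hopfLax_eq hq h₀ (0, x)
  have := gammaConst_pos hq
  have h1 : 0 ≤ gammaConst q * ‖a‖ ^ (q / (q - 1)) := by positivity
  rw [ha, hz, zero_smul, sub_zero]
  linarith

lemma sub_hopfLaxKernel_le_hopfLax (hq : 1 < q) (h0 : ∀ x, 0 ≤ h₀ x) {t : ℝ} (ht : 0 < t)
    (x z : RN N) : h₀ z - hopfLaxKernel q t (x - z) ≤ hopfLax q h₀ (t, x) := by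
  have hpos : 0 < t ^ (1 / q) := Real.rpow_pos_of_pos ht _
  have h1 := le_hopfLax hq h0 (t, x) ((t ^ (1 / q))⁻¹ • (x - z))
  rw [← hopfLaxKernel_smul hq ht, smul_inv_smul₀ hpos.ne'] at h1
  simpa using h1

lemma exists_hopfLax_eq_sub_hopfLaxKernel (hq : 1 < q) (h₀ : C₀(RN N, ℝ)) {t : ℝ} (ht : 0 < t)
    (x : RN N) : ∃ z, hopfLax q h₀ (t, x) = h₀ z - hopfLaxKernel q t (x - z) := by
  obtain ⟨a, ha⟩ := exists_hopfLax_eq hq h₀ (t, x)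
  refine ⟨x - t ^ (1 / q) • a, ?_⟩
  rw [ha, sub_sub_cancel, hopfLaxKernel_smul hq ht]

/-- Dynamic programming inequality: a competitor `z` optimal at `(t - s, x - s a)` is admissible at
`(t, x)`, at the extra cost of moving with velocity `a` for time `s`. -/
lemma hopfLax_sub_le_hopfLax (hq : 1 < q) (h0 : ∀ x, 0 ≤ h₀ x) {s t : ℝ} (hs : 0 < s)
    (hst : s < t) (x a : RN N) :
    hopfLax q h₀ (t - s, x - s • a) - s * (gammaConst q * ‖a‖ ^ (q / (q - 1))) ≤
      hopfLax q h₀ (t, x) := by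
  obtain ⟨z, hz⟩ := exists_hopfLax_eq_sub_hopfLaxKernel hq h₀ (sub_pos.2 hst) (x - s • a)
  have h1 := hopfLaxKernel_le_add hq hs hst (x - z) a
  have h2 := sub_hopfLaxKernel_le_hopfLax hq h0 (hs.trans hst) x z
  rw [sub_right_comm] at h1
  linarith

end hopfLax

/-! ### Viscosity property of the Hopf–Lax formula -/

section hopfLax

variable {q : ℝ} {h₀ : C₀(RN N, ℝ)}

theorem isViscositySubsolution_hopfLax (hq : 1 < q) (h0 : ∀ x, 0 ≤ h₀ x) :
    IsViscositySubsolution (hamiltonian q) fun τ y => hopfLax q h₀ (rescale q (τ, y)) := by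
  intro φ hφ τ hτ y hmax
  have ht := rescale_fst_pos (zero_lt_one.trans hq) hτ
  obtain ⟨D, hD⟩ : ∃ D : ℝ × RN N →L[ℝ] ℝ,
      HasFDerivAt (fun p : ℝ × RN N => φ p.1 p.2) D (τ, y) :=
    ⟨_, hasFDerivAt_of_contDiffOn hφ hτ y⟩
  obtain ⟨z, hz⟩ := exists_hopfLax_eq_sub_hopfLaxKernel hq h₀ ht (Real.exp τ • y)
  obtain ⟨E, hE, hEeq⟩ := exists_hasFDerivAt_const_sub_hopfLaxKernel hq (h₀ z) 0 z
    (t := Real.exp (q * τ) - 1) (by simpa using ht) (Real.exp τ • y)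
  obtain ⟨E', hE', hE'eq⟩ := exists_hasFDerivAt_comp_rescale (q := q) (τ := τ) (y := y) hE
  simp only [add_zero] at hE'
  have hloc : IsLocalMax (fun p : ℝ × RN N =>
      h₀ z - hopfLaxKernel q (rescale q p).1 ((rescale q p).2 - z) - φ p.1 p.2) (τ, y) := by
    have hnhds : Ioi (0 : ℝ) ×ˢ (univ : Set (RN N)) ∈ 𝓝 (τ, y) :=
      prod_mem_nhds (Ioi_mem_nhds hτ) univ_mem
    filter_upwards [hnhds, hmax]
    rintro ⟨s, x⟩ ⟨hs : 0 < s, -⟩ hle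
    have h1 := sub_hopfLaxKernel_le_hopfLax hq h0 (rescale_fst_pos (zero_lt_one.trans hq) hs)
      (Real.exp s • x) z
    simp only [rescale] at hle ⊢
    linarith
  -- The exact solution for the optimal `z` lies below the Hopf–Lax function and agrees with it at
  -- `(τ, y)`, so its difference with `φ` also has a local maximum there.
  have hDE : E' = D := sub_eq_zero.1 (hloc.hasFDerivAt_eq_zero (hE'.sub hD))
  rw [deriv_add_hamiltonian_eq hD, ← hDE, hE'eq, hEeq, sub_self, mul_zero]

lemma deriv_nonpos_of_eventually_le {F : ℝ → ℝ} {F' : ℝ} (hF : HasDerivAt F F' 0)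
    (hle : ∀ᶠ σ in 𝓝[>] (0 : ℝ), F σ ≤ F 0) : F' ≤ 0 := by
  have h1 := hF.tendsto_slope.mono_left (nhdsGT_le_nhdsNE 0)
  refine le_of_tendsto h1 ?_
  filter_upwards [hle, self_mem_nhdsWithin] with σ hσ hpos
  have hpos : 0 < σ := hpos
  rw [slope_def_field, sub_zero]
  exact div_nonpos_of_nonpos_of_nonneg (by linarith) hpos.le

theorem isViscositySupersolution_hopfLax (hq : 1 < q) (h0 : ∀ x, 0 ≤ h₀ x) :
    IsViscositySupersolution (hamiltonian q) fun τ y => hopfLax q h₀ (rescale q (τ, y)) := by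
  intro φ hφ τ hτ y hmin
  have hq0 : 0 < q := zero_lt_one.trans hq
  obtain ⟨D, hD⟩ : ∃ D : ℝ × RN N →L[ℝ] ℝ,
      HasFDerivAt (fun p : ℝ × RN N => φ p.1 p.2) D (τ, y) :=
    ⟨_, hasFDerivAt_of_contDiffOn hφ hτ y⟩
  rw [deriv_add_hamiltonian_eq hD]
  -- `e^{-τ} • spatialPart D` is the gradient in the variable `x = e^τ y`; the sign reflects the
  -- backward motion `x - s a`.
  obtain ⟨a, ha⟩ := exists_norm_rpow_eq hq (-(Real.exp (-τ) • spatialPart D))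
  set L := gammaConst q * ‖a‖ ^ (q / (q - 1)) with hL
  -- The curve `c` is the preimage under `rescale q` of `(t - s, x - s a)`, and `s` is the time `t`
  -- elapsed when `τ` decreases by `σ`. Along `c`, dynamic programming and the local minimum bound
  -- `φ - s L` by its value at `σ = 0`.
  set s : ℝ → ℝ := fun σ => Real.exp (q * τ) - Real.exp (q * (τ - σ)) with hs
  set c : ℝ → ℝ × RN N := fun σ =>
    (τ - σ, Real.exp (-(τ - σ)) • (Real.exp τ • y - s σ • a)) with hc
  have hs0 : s 0 = 0 := by simp [hs]
  have hc0 : c 0 = (τ, y) := by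
    simp [hc, hs0, smul_smul, ← Real.exp_add]
  have hs' : HasDerivAt s (q * Real.exp (q * τ)) 0 := by
    have := ((((hasDerivAt_id (0 : ℝ)).const_sub τ).const_mul q).exp).const_sub (Real.exp (q * τ))
    simpa [mul_comm] using this
  have he' : HasDerivAt (fun σ => Real.exp (-(τ - σ))) (Real.exp (-τ)) 0 := by
    have := (((hasDerivAt_id (0 : ℝ)).const_sub τ).fun_neg).exp
    simpa using this
  have hc' : HasDerivAt c (-1, y - (Real.exp (-τ) * (q * Real.exp (q * τ))) • a) 0 := by
    refine HasDerivAt.prodMk ((hasDerivAt_id (0 : ℝ)).const_sub τ) ?_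
    have := he'.smul ((hs'.smul_const a).const_sub (Real.exp τ • y))
    refine this.congr_deriv ?_
    rw [hs0, zero_smul, sub_zero, sub_zero, smul_smul, ← Real.exp_add, neg_add_cancel,
      Real.exp_zero, one_smul, smul_neg, smul_smul]
    abel
  have hF : HasDerivAt (fun σ => φ (c σ).1 (c σ).2 - s σ * L)
      (D (-1, y - (Real.exp (-τ) * (q * Real.exp (q * τ))) • a) - q * Real.exp (q * τ) * L) 0 :=
    (HasFDerivAt.comp_hasDerivAt (l := fun p : ℝ × RN N => φ p.1 p.2) (f := c) 0
      (by rwa [hc0]) hc').sub (hs'.mul_const L)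
  have hle := deriv_nonpos_of_eventually_le hF ?_
  · have hdec : ((-1 : ℝ), y - (Real.exp (-τ) * (q * Real.exp (q * τ))) • a) =
        -((1 : ℝ), (0 : RN N)) + ((0 : ℝ), y) -
          (Real.exp (-τ) * (q * Real.exp (q * τ))) • ((0 : ℝ), a) := by simp
    rw [hdec, map_sub, map_add, map_neg, map_smul, smul_eq_mul] at hle
    have hexp : Real.exp (-τ) ^ q * Real.exp (q * τ) = 1 := by
      rw [← Real.exp_mul, ← Real.exp_add]
      simp [mul_comm]
    rw [norm_neg, norm_smul, Real.norm_of_nonneg (Real.exp_pos _).le,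
      Real.mul_rpow (Real.exp_pos _).le (norm_nonneg _)] at ha
    simp only [neg_apply, smul_apply, smul_eq_mul, spatialPart_apply] at ha
    have h2 : q * Real.exp (q * τ) * (-(Real.exp (-τ) * D (0, a)) - L) =
        q * ‖spatialPart D‖ ^ q := by
      rw [ha]
      linear_combination (q * ‖spatialPart D‖ ^ q) * hexp
    linarith
  · have hcont : Tendsto c (𝓝[>] 0) (𝓝 (τ, y)) := by
      have := hc'.continuousAt.tendsto
      rw [hc0] at this
      exact this.mono_left nhdsWithin_le_nhds
    filter_upwards [hcont.eventually hmin, Ioo_mem_nhdsGT hτ] with σ h1 hσ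
    have ht := rescale_fst_pos hq0 hτ
    have hspos : 0 < s σ := by
      simp only [hs, sub_pos, Real.exp_lt_exp]
      exact mul_lt_mul_of_pos_left (by linarith [hσ.1]) hq0
    have hst : s σ < Real.exp (q * τ) - 1 := by
      have := rescale_fst_pos hq0 (sub_pos.2 hσ.2)
      simp only [hs]
      linarith
    have h2 := hopfLax_sub_le_hopfLax hq h0 hspos hst (Real.exp τ • y) a
    have h3 : rescale q (c σ) = (Real.exp (q * τ) - 1 - s σ, Real.exp τ • y - s σ • a) := by
      simp only [rescale, hc, hs]
      refine Prod.ext (by simp) ?_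
      simp only
      rw [smul_smul, ← Real.exp_add, add_neg_cancel, Real.exp_zero, one_smul]
    simp only [hc0, hs0, zero_mul, sub_zero]
    simp only [Prod.mk.eta, h3] at h1
    simp only [rescale] at h1
    linarith

theorem isBCViscositySolution_hopfLax (hq : 1 < q) (h0 : ∀ x, 0 ≤ h₀ x) :
    IsBCViscositySolution (hamiltonian q) h₀ fun τ y => hopfLax q h₀ (rescale q (τ, y)) where
  continuousOn := ((continuous_hopfLax hq h₀).comp (contDiff_rescale q).continuous).continuousOn
  bounded := ⟨‖h₀‖, fun τ _ y => by
    rw [abs_of_nonneg (hopfLax_nonneg hq h0 _)]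
    exact hopfLax_le_norm hq _⟩
  initial y := by simpa [rescale] using hopfLax_zero hq h0 y
  subsolution := isViscositySubsolution_hopfLax hq h0
  supersolution := isViscositySupersolution_hopfLax hq h0

end hopfLax

/-! ### Uniqueness -/

/-- Self-similarity trades the dilation `e^τ` for a time change; with `T = e^{qτ} - 1` the new time
`1 - e^{-qτ}` tends to `1`. -/
lemma hopfLaxKernel_exp_smul {q : ℝ} (hq : 1 < q) {T : ℝ} (hT : 0 < T) (τ : ℝ) (w : RN N) :
    hopfLaxKernel q T (Real.exp τ • w) = hopfLaxKernel q (Real.exp (-(q * τ)) * T) w := by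
  have h1 : q - 1 ≠ 0 := by linarith
  rw [hopfLaxKernel, hopfLaxKernel, norm_smul, Real.norm_of_nonneg (Real.exp_pos τ).le,
    Real.mul_rpow (Real.exp_pos τ).le (norm_nonneg _), Real.mul_rpow (Real.exp_pos _).le hT.le,
    ← Real.exp_mul, ← Real.exp_mul]
  have : -(q * τ) * -(1 / (q - 1)) = τ * (q / (q - 1)) := by field_simp
  rw [this]
  ring

lemma gammaConst_mul_le_hopfLaxKernel {q : ℝ} (hq : 1 < q) {s : ℝ} (hs : 0 < s) (hs1 : s ≤ 1)
    (w : RN N) : gammaConst q * ‖w‖ ^ (q / (q - 1)) ≤ hopfLaxKernel q s w := by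
  have h1 : 1 ≤ s ^ (-(1 / (q - 1))) :=
    Real.one_le_rpow_of_pos_of_le_one_of_nonpos hs hs1
      (neg_nonpos.2 (one_div_nonneg.2 (by linarith)))
  have hγ := gammaConst_pos hq
  unfold hopfLaxKernel
  gcongr
  exact le_mul_of_one_le_right (by positivity) h1

lemma exp_smul_sub (τ : ℝ) (y z : RN N) :
    Real.exp τ • y - z = Real.exp τ • (y - Real.exp (-τ) • z) := by
  rw [smul_sub, smul_smul, ← Real.exp_add, add_neg_cancel, Real.exp_zero, one_smul]

lemma gammaConst_mul_le_hopfLaxKernel_exp {q : ℝ} (hq : 1 < q) {τ T : ℝ} (hT : 0 < T)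
    (hTτ : T ≤ Real.exp (q * τ)) (y z : RN N) :
    gammaConst q * ‖y - Real.exp (-τ) • z‖ ^ (q / (q - 1)) ≤
      hopfLaxKernel q T (Real.exp τ • y - z) := by
  rw [exp_smul_sub, hopfLaxKernel_exp_smul hq hT]
  refine gammaConst_mul_le_hopfLaxKernel hq (by positivity) ?_ _
  rw [Real.exp_neg, inv_mul_le_iff₀ (Real.exp_pos _)]
  linarith

lemma exists_le_gammaConst_mul {q : ℝ} (hq : 1 < q) (C : ℝ) :
    ∃ r, ∀ s, r ≤ s → C ≤ gammaConst q * s ^ (q / (q - 1)) := by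
  have h := (tendsto_rpow_atTop (zero_lt_one.trans (one_lt_conj hq))).const_mul_atTop
    (gammaConst_pos hq)
  exact eventually_atTop.1 (h.eventually_ge_atTop C)

lemma continuousAt_hopfLaxKernel (q : ℝ) {t : ℝ} (ht : 0 < t) (x : RN N) :
    ContinuousAt (fun s => hopfLaxKernel q s x) t := by
  unfold hopfLaxKernel
  exact continuousAt_const.mul (continuousAt_const.mul
    (Real.continuousAt_rpow_const _ _ (Or.inl ht.ne')))

lemma contDiffOn_Ioi_const_sub_hopfLaxKernel {q : ℝ} (hq : 1 < q) (c : ℝ) {δ : ℝ} (hδ : 0 < δ)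
    (z : RN N) : ContDiffOn ℝ 1 (fun p : ℝ × RN N => c - hopfLaxKernel q (p.1 + δ) (p.2 - z))
      (Ioi 0 ×ˢ univ) :=
  (contDiffOn_const_sub_hopfLaxKernel hq c z).mono
    (prod_mono (fun t (ht : 0 < t) => show -δ < t by linarith) subset_rfl)

lemma continuousOn_Ici_const_sub_hopfLaxKernel {q : ℝ} (hq : 1 < q) (c : ℝ) {δ : ℝ} (hδ : 0 < δ)
    (z : RN N) : ContinuousOn (fun p : ℝ × RN N => c - hopfLaxKernel q (p.1 + δ) (p.2 - z))
      (Ici 0 ×ˢ univ) :=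
  (contDiffOn_const_sub_hopfLaxKernel hq c z).continuousOn.mono
    (prod_mono (fun t (ht : 0 ≤ t) => show -δ < t by linarith) subset_rfl)

section

variable {q : ℝ} {h₀ : C₀(RN N, ℝ)}

/-- Near `z` the slack `η` absorbs the oscillation of `h₀`; away from `z` the kernel exceeds `‖h₀‖`
for small `δ`, and `h₀ ≥ 0`. -/
lemma eventually_sub_hopfLaxKernel_le (hq : 1 < q) (h0 : ∀ x, 0 ≤ h₀ x) {η : ℝ} (hη : 0 < η)
    (z : RN N) : ∀ᶠ δ in 𝓝[>] (0 : ℝ), ∀ x, h₀ z - η - hopfLaxKernel q δ (x - z) ≤ h₀ x := by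
  have hγ := gammaConst_pos hq
  have hα : 0 < 1 / (q - 1) := one_div_pos.2 (by linarith)
  obtain ⟨r, hr, hrz⟩ := Metric.continuousAt_iff.1 ((map_continuous h₀).continuousAt (x := z)) η hη
  have h1 : Tendsto (fun δ : ℝ => gammaConst q * r ^ (q / (q - 1)) * δ ^ (-(1 / (q - 1))))
      (𝓝[>] 0) atTop :=
    (tendsto_rpow_neg_nhdsGT_zero (neg_neg_of_pos hα)).const_mul_atTop (by positivity)
  filter_upwards [h1.eventually_ge_atTop ‖h₀‖, self_mem_nhdsWithin] with δ hδ hδ0 x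
  have hδ0 : 0 < δ := hδ0
  by_cases hx : dist x z < r
  · have h2 := hrz hx
    rw [Real.dist_eq, abs_lt] at h2
    linarith [hopfLaxKernel_nonneg hq hδ0.le (x - z)]
  · rw [not_lt, dist_eq_norm] at hx
    have h2 : gammaConst q * r ^ (q / (q - 1)) * δ ^ (-(1 / (q - 1))) ≤
        hopfLaxKernel q δ (x - z) := by
      have := one_lt_conj hq
      rw [hopfLaxKernel, ← mul_assoc]
      gcongr
    linarith [apply_le_norm h₀ z, h0 x]

theorem IsBCViscositySolution.sub_hopfLaxKernel_le (hq : 1 < q) (h0 : ∀ x, 0 ≤ h₀ x)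
    {g : ℝ → RN N → ℝ} (hg : IsBCViscositySolution (hamiltonian q) h₀ g) {τ : ℝ} (hτ : 0 < τ)
    (y z : RN N) :
    h₀ z - hopfLaxKernel q (Real.exp (q * τ) - 1) (Real.exp τ • y - z) ≤ g τ y := by
  have hq0 : 0 < q := zero_lt_one.trans hq
  refine le_of_forall_pos_sub_le fun η hη => ?_
  have hlim : Tendsto (fun δ => h₀ z - η -
      hopfLaxKernel q (Real.exp (q * τ) - 1 + δ) (Real.exp τ • y - z)) (𝓝[>] 0)
      (𝓝 (h₀ z - η - hopfLaxKernel q (Real.exp (q * τ) - 1) (Real.exp τ • y - z))) := by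
    refine tendsto_const_nhds.sub ?_
    have h1 := (continuousAt_hopfLaxKernel q (rescale_fst_pos hq0 hτ) (Real.exp τ • y - z)).tendsto
    refine h1.comp ?_
    have h2 : Tendsto (fun δ : ℝ => Real.exp (q * τ) - 1 + δ) (𝓝 0)
        (𝓝 (Real.exp (q * τ) - 1 + 0)) := tendsto_const_nhds.add tendsto_id
    rw [add_zero] at h2
    exact h2.mono_left nhdsWithin_le_nhds
  rw [sub_right_comm]
  refine le_of_tendsto hlim ?_
  -- The bound `δ ≤ 1` gives `e^{qσ} - 1 + δ ≤ e^{qσ}`, which makes the decay in `y` uniform in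
  -- time.
  filter_upwards [eventually_sub_hopfLaxKernel_le hq h0 hη z, Ioc_mem_nhdsGT zero_lt_one]
    with δ hδ hδ1
  refine hg.ge_of_smooth_subsolution hq0
    (contDiffOn_Ioi_const_sub_hopfLaxKernel hq (h₀ z - η) hδ1.1 z)
    (continuousOn_Ici_const_sub_hopfLaxKernel hq (h₀ z - η) hδ1.1 z) (fun t ht x => ?_)
    (by simpa using hδ) (K := h₀ z - η) (fun t ht x => ?_) (fun C => ?_) hτ.le y
  · obtain ⟨D, hD, hDeq⟩ := exists_hasFDerivAt_const_sub_hopfLaxKernel hq (h₀ z - η) δ z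
      (add_pos ht hδ1.1) x
    rw [hD.fderiv, hDeq]
  · exact sub_le_self _ (hopfLaxKernel_nonneg hq (add_nonneg ht hδ1.1.le) _)
  · obtain ⟨r, hr⟩ := exists_le_gammaConst_mul hq (h₀ z - η - C)
    refine ⟨‖z‖ + r, fun σ hσ x hx => ?_⟩
    have he : 1 ≤ Real.exp (q * σ) := Real.one_le_exp (mul_nonneg hq0.le hσ)
    have h1 := gammaConst_mul_le_hopfLaxKernel_exp hq (τ := σ) (T := Real.exp (q * σ) - 1 + δ)
      (by linarith [hδ1.1]) (by linarith [hδ1.2]) x z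
    have h2 : r ≤ ‖x - Real.exp (-σ) • z‖ := by
      have h3 : ‖Real.exp (-σ) • z‖ ≤ ‖z‖ := by
        rw [norm_smul, Real.norm_of_nonneg (Real.exp_pos _).le]
        exact mul_le_of_le_one_left (norm_nonneg _) (Real.exp_le_one_iff.2 (by linarith))
      linarith [norm_sub_norm_le x (Real.exp (-σ) • z)]
    have := hr _ h2
    simp only [rescale]
    linarith

/-- The kernel vanishes at `0`, so by continuity the function centred at `z` dominates `h₀` near
`z`. Finitely many centres cover the compact set outside which `h₀ < η`. -/
lemma exists_finset_le_sub_hopfLaxKernel (hq : 1 < q) (h₀ : C₀(RN N, ℝ)) {η : ℝ} (hη : 0 < η)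
    (δ : ℝ) : ∃ F : Finset (RN N), ∀ x, h₀ x ≤ η ∨
      ∃ z ∈ F, h₀ x ≤ h₀ z + η - hopfLaxKernel q δ (x - z) := by
  have hsmall : ∀ᶠ x in cocompact (RN N), h₀ x < η :=
    (zero_at_infty h₀).eventually (Iio_mem_nhds hη)
  obtain ⟨K, hK, hKη⟩ := mem_cocompact.1 hsmall
  have hU : ∀ z ∈ K, {x | h₀ x < h₀ z + η - hopfLaxKernel q δ (x - z)} ∈ 𝓝 z := by
    intro z _
    have hc : Continuous fun x => h₀ z + η - hopfLaxKernel q δ (x - z) := by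
      have h1 : Continuous fun x : RN N => ‖x - z‖ ^ (q / (q - 1)) :=
        (Real.continuous_rpow_const (zero_lt_one.trans (one_lt_conj hq)).le).comp (by fun_prop)
      unfold hopfLaxKernel
      fun_prop
    exact (isOpen_lt (map_continuous h₀) hc).mem_nhds (by simp [hopfLaxKernel_zero hq, hη])
  obtain ⟨F, -, hF⟩ := hK.elim_nhds_subcover _ hU
  refine ⟨F, fun x => ?_⟩
  by_cases hx : x ∈ K
  · obtain ⟨z, hz, hxz⟩ := mem_iUnion₂.1 (hF hx)
    exact Or.inr ⟨z, hz, le_of_lt hxz⟩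
  · exact Or.inl (le_of_lt (hKη hx))

/-- A finite family of smooth supersolutions whose maximum is larger than `h₀` at time `0`. -/
def supersolutionFamily (q : ℝ) (h₀ : C₀(RN N, ℝ)) (η δ β : ℝ) : Option (RN N) → ℝ × RN N → ℝ
  | none => coerciveSupersolution q β η
  | some z => fun p => h₀ z + η - hopfLaxKernel q (p.1 + δ) (p.2 - z)

theorem IsBCViscositySolution.le_hopfLax_add (hq : 1 < q) (h0 : ∀ x, 0 ≤ h₀ x)
    {g : ℝ → RN N → ℝ} (hg : IsBCViscositySolution (hamiltonian q) h₀ g) {τ : ℝ} (hτ : 0 ≤ τ)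
    (y : RN N) {η : ℝ} (hη : 0 < η) :
    g τ y ≤ hopfLax q h₀ (Real.exp (q * τ) - 1 + η, Real.exp τ • y) + η := by
  have hq0 : 0 < q := zero_lt_one.trans hq
  set t := Real.exp (q * τ) - 1 with ht
  set x := Real.exp τ • y with hx
  have ht0 : 0 ≤ t := by
    have := mul_nonneg hq0.le hτ
    simpa [ht]
  obtain ⟨F, hF⟩ := exists_finset_le_sub_hopfLaxKernel hq h₀ hη η
  set s : Finset (Option (RN N)) := Finset.insertNone F with hs
  have hsn : s.Nonempty := ⟨none, by simp [hs]⟩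
  -- `β` is both the slope of the coercive member and the width of the soft maximum. The set `s`
  -- depends on `η` but not on `β`, so the error `β log s.card` vanishes as `β → 0`.
  have hlim : Tendsto (fun β : ℝ => hopfLax q h₀ (t + η, x) +
      (η + β * √(1 + ‖x‖ ^ 2) + β ^ q * t) + β * Real.log s.card) (𝓝[>] 0)
      (𝓝 (hopfLax q h₀ (t + η, x) + η)) := by
    have hc : Continuous (fun β : ℝ => hopfLax q h₀ (t + η, x) +
      (η + β * √(1 + ‖x‖ ^ 2) + β ^ q * t) + β * Real.log s.card) := by
      have := Real.continuous_rpow_const hq0.le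
      fun_prop
    have := hc.tendsto 0
    simp only [Real.zero_rpow hq0.ne', zero_mul, add_zero] at this
    exact this.mono_left nhdsWithin_le_nhds
  refine ge_of_tendsto hlim ?_
  filter_upwards [self_mem_nhdsWithin] with β hβ
  have hβ : 0 < β := hβ
  have hcoer : ∀ σ ≥ 0, ∀ v : RN N, η + β * ‖v‖ ≤ coerciveSupersolution q β η (σ, v) := by
    intro σ hσ v
    have h1 : ‖v‖ ≤ √(1 + ‖v‖ ^ 2) := Real.le_sqrt_of_sq_le (by linarith)
    have h2 : 0 ≤ β ^ q * σ := by positivity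
    have h3 := mul_le_mul_of_nonneg_left h1 hβ.le
    simp only [coerciveSupersolution]
    linarith
  have hnone : ∀ p, coerciveSupersolution q β η p ≤
      softMax s β (supersolutionFamily q h₀ η η β) p := fun p =>
    le_softMax (φ := supersolutionFamily q h₀ η η β) hβ (i := none) (by simp [hs]) p
  have hle : g τ y ≤ softMax s β (supersolutionFamily q h₀ η η β) (rescale q (τ, y)) := by
    refine hg.le_of_smooth_supersolution hq0 (contDiffOn_softMax hsn ?_)
      (continuousOn_softMax hsn ?_) (fun σ hσ v => ?_) (fun v => ?_) (K := 0) (fun σ hσ v => ?_)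
      (fun C => ⟨C / β, fun σ hσ v hv => ?_⟩) hτ y
    · rintro (_ | z) _
      · exact (contDiff_coerciveSupersolution q β η).contDiffOn
      · exact contDiffOn_Ioi_const_sub_hopfLaxKernel hq _ hη z
    · rintro (_ | z) _
      · exact (contDiff_coerciveSupersolution q β η).continuous.continuousOn
      · exact continuousOn_Ici_const_sub_hopfLaxKernel hq _ hη z
    · have hD : ∀ i, ∃ D : ℝ × RN N →L[ℝ] ℝ,
          HasFDerivAt (supersolutionFamily q h₀ η η β i) D (σ, v) ∧
            ‖spatialPart D‖ ^ q ≤ D (1, 0) := by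
        rintro (_ | z)
        · exact exists_hasFDerivAt_coerciveSupersolution hq hβ.le η (σ, v)
        · obtain ⟨D, hD, hDeq⟩ := exists_hasFDerivAt_const_sub_hopfLaxKernel hq (h₀ z + η) η z
            (add_pos hσ hη) v
          exact ⟨D, hD, hDeq.ge⟩
      choose D hD hDle using hD
      exact norm_spatialPart_fderiv_softMax_le hsn hβ hq (fun i _ => hD i) fun i _ => hDle i
    · rcases hF v with h | ⟨z, hz, h⟩
      · refine le_trans ?_ (hnone _)
        have := hcoer 0 le_rfl v
        have := mul_nonneg hβ.le (norm_nonneg v)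
        linarith
      · refine le_trans ?_ (le_softMax (φ := supersolutionFamily q h₀ η η β) hβ (i := some z)
          (by simpa [hs] using hz) _)
        simpa [supersolutionFamily] using h
    · refine le_trans ?_ (hnone _)
      have := hcoer σ hσ v
      have := mul_nonneg hβ.le (norm_nonneg v)
      linarith
    · refine le_trans ?_ (hnone _)
      have he : 0 ≤ Real.exp (q * σ) - 1 := by simpa using mul_nonneg hq0.le hσ
      have h1 := hcoer _ he (Real.exp σ • v)
      rw [norm_smul, Real.norm_of_nonneg (Real.exp_pos σ).le] at h1
      have h2 : ‖v‖ ≤ Real.exp σ * ‖v‖ :=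
        le_mul_of_one_le_left (norm_nonneg _) (Real.one_le_exp hσ)
      have h3 := mul_le_mul_of_nonneg_left h2 hβ.le
      rw [div_lt_iff₀ hβ] at hv
      simp only [rescale]
      linarith
  refine hle.trans (softMax_le hsn hβ ?_)
  have hψ : 0 ≤ β * √(1 + ‖x‖ ^ 2) + β ^ q * t := by positivity
  rintro (_ | z) _
  · have := hopfLax_nonneg hq h0 (t + η, x)
    simp only [supersolutionFamily, coerciveSupersolution, rescale]
    linarith
  · have := sub_hopfLaxKernel_le_hopfLax hq h0 (by positivity : 0 < t + η) x z
    simp only [supersolutionFamily, rescale]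
    linarith

theorem IsBCViscositySolution.eq_hopfLax (hq : 1 < q) (h0 : ∀ x, 0 ≤ h₀ x)
    {g : ℝ → RN N → ℝ} (hg : IsBCViscositySolution (hamiltonian q) h₀ g) {τ : ℝ} (hτ : 0 ≤ τ)
    (y : RN N) : g τ y = hopfLax q h₀ (rescale q (τ, y)) := by
  rcases hτ.eq_or_lt with rfl | hτ
  · rw [hg.initial]
    simp [rescale, hopfLax_zero hq h0]
  refine le_antisymm ?_ ?_
  · have hc : Continuous fun η : ℝ =>
        hopfLax q h₀ (Real.exp (q * τ) - 1 + η, Real.exp τ • y) + η :=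
      ((continuous_hopfLax hq h₀).comp (by fun_prop)).add continuous_id
    have hlim := (hc.tendsto 0).mono_left (nhdsWithin_le_nhds (s := Ioi 0))
    simp only [add_zero] at hlim
    refine ge_of_tendsto hlim ?_
    filter_upwards [self_mem_nhdsWithin] with η hη
    exact hg.le_hopfLax_add hq h0 hτ.le y hη
  · obtain ⟨z, hz⟩ := exists_hopfLax_eq_sub_hopfLaxKernel hq h₀
      (rescale_fst_pos (zero_lt_one.trans hq) hτ) (Real.exp τ • y)
    rw [rescale, hz]
    exact hg.sub_hopfLaxKernel_le hq h0 hτ y z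

end

/-! ### Large time behaviour -/

section

variable {q : ℝ} {h₀ : C₀(RN N, ℝ)}

/-- Compact support gives uniformity, which later absorbs the shift `e^{-τ}z` for all `y` at once.
-/
lemma uniformContinuous_profile (hq : 1 < q) (M : ℝ) :
    UniformContinuous (profile q M : RN N → ℝ) := by
  have hcont : Continuous (profile q M : RN N → ℝ) := by
    have h1 : Continuous fun y : RN N => ‖y‖ ^ (q / (q - 1)) :=
      (Real.continuous_rpow_const (zero_lt_one.trans (one_lt_conj hq)).le).comp continuous_norm
    unfold profile
    fun_prop
  obtain ⟨r, hr⟩ := exists_le_gammaConst_mul hq M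
  have hsupp : HasCompactSupport (profile q M : RN N → ℝ) := by
    refine HasCompactSupport.intro (isCompact_closedBall 0 r) fun y hy => ?_
    have := hr ‖y‖ (by simpa using hy : r < ‖y‖).le
    exact max_eq_right (by linarith)
  exact hsupp.uniformContinuous_of_continuous hcont

lemma exists_norm_sub_lt_apply (h0 : ∀ x, 0 ≤ h₀ x) {ε : ℝ} (hε : 0 < ε) :
    ∃ z, ‖h₀‖ - ε < h₀ z := by
  by_contra! h
  have hnn : 0 ≤ ‖h₀‖ - ε := (h0 0).trans (h 0)
  have : ‖h₀.toBCF‖ ≤ ‖h₀‖ - ε := (BoundedContinuousFunction.norm_le hnn).2 fun x => by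
    rw [Real.norm_eq_abs, ZeroAtInftyContinuousMap.toBCF_apply, abs_of_nonneg (h0 x)]
    exact h x
  rw [ZeroAtInftyContinuousMap.norm_toBCF_eq_norm] at this
  linarith

lemma tendsto_exp_neg_mul_atTop {q : ℝ} (hq : 0 < q) :
    Tendsto (fun τ : ℝ => Real.exp (-(q * τ))) atTop (𝓝 0) :=
  Real.tendsto_exp_neg_atTop_nhds_zero.comp (tendsto_id.const_mul_atTop hq)

theorem eventually_hopfLax_rescale_le (hq : 1 < q) {ε : ℝ} (hε : 0 < ε) :
    ∀ᶠ τ in atTop, ∀ y, hopfLax q h₀ (rescale q (τ, y)) ≤ profile q ‖h₀‖ y + ε := by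
  have hq0 : 0 < q := zero_lt_one.trans hq
  obtain ⟨δ, hδ, hδε⟩ := Metric.uniformContinuous_iff.1
    (uniformContinuous_profile (N := N) hq ‖h₀‖) ε hε
  have hsmall : ∀ᶠ x in cocompact (RN N), h₀ x < ε :=
    (zero_at_infty h₀).eventually (Iio_mem_nhds hε)
  obtain ⟨K, hK, hKε⟩ := mem_cocompact.1 hsmall
  obtain ⟨R, hR⟩ := hK.isBounded.exists_norm_le
  have hlim : Tendsto (fun τ : ℝ => Real.exp (-τ) * R) atTop (𝓝 0) := by
    simpa using Real.tendsto_exp_neg_atTop_nhds_zero.mul_const R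
  filter_upwards [hlim.eventually_lt_const hδ, eventually_gt_atTop 0] with τ hτ hτ0 y
  have ht := rescale_fst_pos hq0 hτ0
  obtain ⟨z, hz⟩ := exists_hopfLax_eq_sub_hopfLaxKernel hq h₀ ht (Real.exp τ • y)
  rw [rescale, hz]
  have hprof : 0 ≤ profile q ‖h₀‖ y := le_max_right _ _
  -- An optimal `z` in `K` is shifted by less than `δ`, and its kernel is at least the stationary
  -- one; an optimal `z` outside `K` has `h₀ z < ε` and a nonnegative kernel.
  by_cases hzK : z ∈ K
  · have h1 := gammaConst_mul_le_hopfLaxKernel_exp hq (τ := τ) ht (by linarith) y z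
    have h2 : ‖h₀‖ - gammaConst q * ‖y - Real.exp (-τ) • z‖ ^ (q / (q - 1)) ≤
        profile q ‖h₀‖ (y - Real.exp (-τ) • z) := le_max_left _ _
    have h3 : dist (y - Real.exp (-τ) • z) y < δ := by
      rw [dist_eq_norm, sub_sub_cancel_left, norm_neg, norm_smul,
        Real.norm_of_nonneg (Real.exp_pos _).le]
      exact (mul_le_mul_of_nonneg_left (hR z hzK) (Real.exp_pos _).le).trans_lt hτ
    have h4 := hδε h3
    rw [Real.dist_eq, abs_lt] at h4
    linarith [apply_le_norm h₀ z]
  · have h1 : h₀ z < ε := hKε hzK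
    linarith [hopfLaxKernel_nonneg hq ht.le (Real.exp τ • y - z)]

/-- A single near-maximiser `z` of `h₀` suffices as competitor. One `ε` each pays for `‖h₀‖ - h₀ z`,
for the shift `e^{-τ}z`, and for replacing the kernel time `1 - e^{-qτ}` by `1`. -/
theorem eventually_le_hopfLax_rescale (hq : 1 < q) (h0 : ∀ x, 0 ≤ h₀ x) {ε : ℝ} (hε : 0 < ε) :
    ∀ᶠ τ in atTop, ∀ y, profile q ‖h₀‖ y - 3 * ε ≤ hopfLax q h₀ (rescale q (τ, y)) := by
  have hq0 : 0 < q := zero_lt_one.trans hq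
  obtain ⟨δ, hδ, hδε⟩ := Metric.uniformContinuous_iff.1
    (uniformContinuous_profile (N := N) hq ‖h₀‖) ε hε
  obtain ⟨z, hz⟩ := exists_norm_sub_lt_apply h0 hε
  have hlim : Tendsto (fun τ : ℝ => Real.exp (-τ) * ‖z‖) atTop (𝓝 0) := by
    simpa using Real.tendsto_exp_neg_atTop_nhds_zero.mul_const ‖z‖
  have hk : Tendsto (fun τ : ℝ => ((1 - Real.exp (-(q * τ))) ^ (-(1 / (q - 1))) - 1) * ‖h₀‖)
      atTop (𝓝 0) := by
    have h1 := (tendsto_const_nhds (x := (1 : ℝ))).sub (tendsto_exp_neg_mul_atTop hq0)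
    rw [sub_zero] at h1
    have h2 := ((h1.rpow_const (p := -(1 / (q - 1))) (Or.inl one_ne_zero)).sub_const 1).mul_const
      ‖h₀‖
    simpa using h2
  filter_upwards [hlim.eventually_lt_const hδ, hk.eventually_lt_const hε, eventually_gt_atTop 0]
    with τ hτ hkτ hτ0 y
  have ht := rescale_fst_pos hq0 hτ0
  have hnn := hopfLax_nonneg hq h0 (rescale q (τ, y))
  set w := y - Real.exp (-τ) • z with hw
  set m := gammaConst q * ‖w‖ ^ (q / (q - 1)) with hm
  have h1 : profile q ‖h₀‖ y - ε ≤ profile q ‖h₀‖ w := by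
    have h3 : dist w y < δ := by
      rw [dist_eq_norm, hw, sub_sub_cancel_left, norm_neg, norm_smul,
        Real.norm_of_nonneg (Real.exp_pos _).le]
      exact hτ
    have h4 := hδε h3
    rw [Real.dist_eq, abs_lt] at h4
    linarith
  have hprof : profile q ‖h₀‖ w = max (‖h₀‖ - m) 0 := rfl
  -- Where the shifted profile vanishes, nonnegativity of the Hopf–Lax function is enough. Elsewhere
  -- `m ≤ ‖h₀‖`, which bounds the kernel error `(k - 1) m` uniformly in `y`.
  rcases le_total ‖h₀‖ m with hle | hle
  · rw [hprof, max_eq_right (by linarith)] at h1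
    linarith
  · rw [hprof, max_eq_left (by linarith)] at h1
    have h2 := sub_hopfLaxKernel_le_hopfLax hq h0 ht (Real.exp τ • y) z
    have hκ : Real.exp (-(q * τ)) * (Real.exp (q * τ) - 1) = 1 - Real.exp (-(q * τ)) := by
      rw [mul_sub, ← Real.exp_add, neg_add_cancel, Real.exp_zero, mul_one]
    have hκ1 : 0 < 1 - Real.exp (-(q * τ)) := by
      rw [← hκ]; positivity
    rw [exp_smul_sub, hopfLaxKernel_exp_smul hq ht, hκ, hopfLaxKernel, ← mul_assoc, ← hw,
      ← hm] at h2
    set k := (1 - Real.exp (-(q * τ))) ^ (-(1 / (q - 1))) with hkdef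
    have hk1 : 1 ≤ k := Real.one_le_rpow_of_pos_of_le_one_of_nonpos hκ1
      (by linarith [Real.exp_pos (-(q * τ))]) (neg_nonpos.2 (one_div_nonneg.2 (by linarith)))
    have h3 : (k - 1) * m ≤ (k - 1) * ‖h₀‖ := mul_le_mul_of_nonneg_left hle (by linarith)
    rw [rescale]
    linarith

theorem tendstoUniformly_hopfLax_rescale (hq : 1 < q) (h0 : ∀ x, 0 ≤ h₀ x) :
    TendstoUniformly (fun τ y => hopfLax q h₀ (rescale q (τ, y))) (profile q ‖h₀‖) atTop := by
  rw [Metric.tendstoUniformly_iff]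
  intro ε hε
  -- The lower bound loses three such terms, and the distance must be strictly below `ε`.
  have hε4 : 0 < ε / 4 := by positivity
  filter_upwards [eventually_hopfLax_rescale_le (h₀ := h₀) hq hε4,
    eventually_le_hopfLax_rescale hq h0 hε4] with τ h1 h2 y
  rw [Real.dist_eq, abs_lt]
  constructor <;> linarith [h1 y, h2 y]

end

end

theorem propositionA1 (N : ℕ) (q : ℝ) (hq : 1 < q) (h₀ : C₀(EuclideanSpace ℝ (Fin N), ℝ))
    (h₀_nonneg : ∀ y, 0 ≤ h₀ y) :
    ∃ h : ℝ → EuclideanSpace ℝ (Fin N) → ℝ,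
      IsBCViscositySolution (hamiltonian q) h₀ h ∧
      (∀ g : ℝ → EuclideanSpace ℝ (Fin N) → ℝ, IsBCViscositySolution (hamiltonian q) h₀ g →
        ∀ τ : ℝ, 0 ≤ τ → ∀ y, g τ y = h τ y) ∧
      TendstoUniformly h (profile q ‖h₀‖) atTop :=
  ⟨fun τ y => hopfLax q h₀ (rescale q (τ, y)), isBCViscositySolution_hopfLax hq h₀_nonneg,
    fun _ hg _ hτ y => hg.eq_hopfLax hq h₀_nonneg hτ y,
    tendstoUniformly_hopfLax_rescale hq h₀_nonneg⟩
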